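/- Let $G$ be a simple graph. A graph map is a function on vertices that sends adjacent vertices to adjacent or equal vertices; $I_m$ ($m\ge 1$) is the path on $0,\dots,m$, $I_\infty$ is the two-sided infinite path on $\mathbb Z$, and powers are taken for the cartesian (box) product of graphs. The box category $\Box$ has the posets $[1]^n=\{0\le 1\}^n$ as objects and its maps are generated under composition by faces, degeneracies, and negative and positive connections (max and min of two neighbouring coordinates); a cubical set is a presheaf on $\Box$, and $\Box^n$ also denotes the cubical set represented by $[1]^n$. For $n\ge 1$, $1\le i\le n$, $\varepsilon\in\{0,1\}$, the open box $\sqcap^n_{i,\varepsilon}\subseteq\Box^n$ is the union of the images of all faces $\partial_{j,\eta}$ with $(j,\eta)\ne(i,\varepsilon)$. A cubical set $X$ is a Kan complex if $X\to\Box^0$ has the right lifting property against all open box inclusions, and a cubical map is anodyne if it belongs to the smallest class of maps that contains all open box inclusions and is closed under pushouts, retracts and transfinite compositions. For $m\ge 1$ the $m$-nerve $N_mG$ is the cubical set with $(N_mG)_n=\{\text{graph maps } I_m^n\to G\}$, and the nerve $NG$ is the cubical set whose $n$-cubes are the graph maps $f\colon I_\infty^n\to G$ that are stable in every direction, i.e.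 for all $i\in\{1,\dots,n\}$ and $\varepsilon\in\{0,1\}$ there is $M\ge 0$ with $f(v_1,\dots,(2\varepsilon-1)t,\dots,v_n)=f(v_1,\dots,(2\varepsilon-1)M,\dots,v_n)$ for all $v$ and all $t>M$ (the displayed entry being the $i$-th). Faces $\partial_{i,\varepsilon}$ evaluate the $i$-th coordinate at $\varepsilon m$, respectively at $(2\varepsilon-1)M$ for $M$ large; degeneracies forget a coordinate, and connections take the maximum or minimum of two neighbouring coordinates. The surjections $l,r\colon I_{m+1}\to I_m$, $l(v)=\max(v-1,0)$, $r(v)=\min(v,m)$, induce cubical maps $l^*,r^*\colon N_mG\to N_{m+1}G$ by precomposition with their $n$-th powers. Let $N_mG\to NG$ be the map that regards $I_m$ as the interval $[-\lfloor m/2\rfloor,\,m-\lfloor m/2\rfloor]$ of $I_\infty$ and extends maps by truncating coordinates to it. Then: 1. $NG$ is a Kan complex. 2. The maps $N_mG\to NG$ exhibit $NG$ as the colimit of $N_1G\xrightarrow{l^*}N_2G\xrightarrow{r^*}N_3G\xrightarrow{l^*}N_4G\xrightarrow{r^*}\cdots$. 3. For every $m\ge 1$ the maps $l^*,r^*\colon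 N_mG\to N_{m+1}G$ are anodyne. 4. The inclusion $N_1G\to NG$ is anodyne. -/

import Mathlib

open CategoryTheory Opposite

universe u

namespace DiscreteCubical

/-! ### Operators on tuples -/

/-- `(x₁, …, xₙ) ↦ (x₁, …, xᵢ₋₁, c, xᵢ, …, xₙ)`. -/
def faceFun {α : Type*} {n : ℕ} (i : Fin (n + 1)) (c : α) (x : Fin n → α) : Fin (n + 1) → α :=
  i.insertNth (α := fun _ => α) c x

/-- `(x₁, …, xₙ₊₁) ↦ (x₁, …, xᵢ₋₁, xᵢ₊₁, …, xₙ₊₁)`. -/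
def degenFun {α : Type*} {n : ℕ} (i : Fin (n + 1)) (x : Fin (n + 1) → α) : Fin n → α :=
  fun j => x (i.succAbove j)

/-- `(x₁, …, xₙ₊₂) ↦ (x₁, …, xᵢ₋₁, xᵢ ∨ xᵢ₊₁, xᵢ₊₂, …, xₙ₊₂)`, where `∨` is `max` if `ε = 0`
(that is, `ε = false`) and `min` if `ε = 1`. -/
def connFun {α : Type*} [LinearOrder α] {n : ℕ} (i : Fin (n + 1)) (ε : Bool)
    (x : Fin (n + 2) → α) : Fin (n + 1) → α :=
  fun j =>
    if j < i then x j.castSucc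
    else if j = i then
      (if ε then min (x j.castSucc) (x j.succ) else max (x j.castSucc) (x j.succ))
    else x j.succ

/-! ### The box category and cubical sets -/

/-- The functions `[1]^m → [1]^n` generated under composition by faces, degeneracies and
the two kinds of connections. Here `[1] = {0 ≤ 1}` is `Bool`. -/
inductive IsBoxMap : ∀ {m n : ℕ}, ((Fin m → Bool) → (Fin n → Bool)) → Prop
  | id (n : ℕ) : IsBoxMap (fun x : Fin n → Bool => x)
  | comp {m n k : ℕ} {f : (Fin m → Bool) → (Fin n → Bool)} {g : (Fin n → Bool) → (Fin k → Bool)} :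
      IsBoxMap f → IsBoxMap g → IsBoxMap (fun x => g (f x))
  | face {n : ℕ} (i : Fin (n + 1)) (ε : Bool) : IsBoxMap (faceFun (α := Bool) i ε)
  | degen {n : ℕ} (i : Fin (n + 1)) : IsBoxMap (degenFun (α := Bool) i)
  | conn {n : ℕ} (i : Fin (n + 1)) (ε : Bool) : IsBoxMap (connFun (α := Bool) i ε)

/-- The objects `[1]^n` of the box category. -/
structure Box : Type where
  /-- the exponent `n` of `[1]^n` -/
  dim : ℕ

instance : SmallCategory Box where
  Hom a b := {f : (Fin a.dim → Bool) → (Fin b.dim → Bool) // IsBoxMap f}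
  id a := ⟨fun x => x, IsBoxMap.id a.dim⟩
  comp f g := ⟨fun x => g.1 (f.1 x), IsBoxMap.comp f.2 g.2⟩

/-- The face `∂_{i,ε} : [1]^n ⟶ [1]^(n+1)` in the box category. -/
def Box.face {n : ℕ} (i : Fin (n + 1)) (ε : Bool) : Box.mk n ⟶ Box.mk (n + 1) :=
  ⟨faceFun i ε, IsBoxMap.face i ε⟩

/-- Cubical sets are presheaves on the box category. -/
abbrev CubicalSet : Type (u + 1) := Boxᵒᵖ ⥤ Type u

/-- The combinatorial `n`-cube (the representable presheaf of `[1]^n`). -/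
abbrev cube (n : ℕ) : CubicalSet.{u} := uliftYoneda.{u}.obj (Box.mk n)

/-- The `(i,ε)`-open box in the `(n+1)`-cube: the union of the images of all the faces
`∂_{j,η}` with `(j,η) ≠ (i,ε)`. -/
def openBox (n : ℕ) (p : Fin (n + 1) × Bool) : Subfunctor (cube.{u} (n + 1)) :=
  ⨆ (q : Fin (n + 1) × Bool) (_ : q ≠ p),
    Subfunctor.range (uliftYoneda.{u}.map (Box.face q.1 q.2))

/-- The class of all open box inclusions in cubes of dimension at least one. -/
def openBoxInclusions : MorphismProperty CubicalSet.{u} :=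
  ⨆ n : ℕ, MorphismProperty.ofHoms (fun p : Fin (n + 1) × Bool => (openBox.{u} n p).ι)

/-- Kan fibrations: the maps with the right lifting property against open box inclusions. -/
def KanFibration : MorphismProperty CubicalSet.{u} := openBoxInclusions.rlp

/-- Kan complexes: the map to the terminal cubical set is a Kan fibration. -/
def IsKanComplex (X : CubicalSet.{u}) : Prop :=
  KanFibration (Limits.terminal.from X)

/-- A class of maps is saturated if it is closed under pushouts, retracts and transfinite
compositions. -/
structure IsSaturated (W : MorphismProperty CubicalSet.{u}) : Prop where
  pushouts : W.IsStableUnderCobaseChange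
  retracts : W.IsStableUnderRetracts
  transfinite : MorphismProperty.IsStableUnderTransfiniteComposition.{u} W

/-- Anodyne maps: the smallest saturated class that contains the open box inclusions. -/
def Anodyne : MorphismProperty CubicalSet.{u} :=
  fun _ _ f => ∀ W : MorphismProperty CubicalSet.{u},
    IsSaturated W → openBoxInclusions ≤ W → W f

/-! ### Graph maps and grids -/

/-- Maps of simple graphs: adjacent vertices have adjacent or equal images. -/
def IsGraphMap {V W : Type*} (G : SimpleGraph V) (H : SimpleGraph W) (f : V → W) : Prop :=
  ∀ ⦃v w : V⦄, G.Adj v w → H.Adj (f v) (f w) ∨ f v = f w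

/-- The `n`-fold cartesian power of the interval graph on `α`, in which two elements of
the linear order `α` are adjacent if they are consecutive. For `α = Fin (m + 1)` this is
`I_m ^ n`, and for `α = ℤ` it is `I_∞ ^ n`. -/
def grid (α : Type*) [LinearOrder α] (n : ℕ) : SimpleGraph (Fin n → α) where
  Adj v w := ∃ i, (SimpleGraph.hasse α).Adj (v i) (w i) ∧ ∀ j, j ≠ i → v j = w j
  symm := ⟨by
    rintro v w ⟨i, h, h'⟩
    exact ⟨i, h.symm, fun j hj => (h' j hj).symm⟩⟩
  loopless := ⟨by
    rintro v ⟨i, h, -⟩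
    exact h.ne rfl⟩

/-- Truncation of `a` to the interval `[lo, hi]`. -/
def clamp {α : Type*} [LinearOrder α] (lo hi a : α) : α := max lo (min hi a)

/-- The action of a monotone map `φ : [1]^k → [1]^n` on tuples with entries in a linear order,
where `lo` and `hi` play the roles of `0` and `1`: the `j`-th coordinate is the lattice polynomial
`⋁_{x, φ(x)ⱼ = 1} ⋀_{i, xᵢ = 1} vᵢ` in which an empty join is `lo` and an empty meet is `hi`.
On faces, degeneracies and connections it is given by the usual formulas, see
`boxAct_face`, `boxAct_degen` and `boxAct_conn` below, and it is compatible with composition,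
see `boxAct_comp`. -/
def boxAct {α : Type*} [LinearOrder α] (lo hi : α) {k n : ℕ}
    (φ : (Fin k → Bool) → (Fin n → Bool)) (v : Fin k → α) : Fin n → α :=
  fun j => (Finset.univ.filter (fun x => φ x j = true)).fold max lo
    (fun x => (Finset.univ.filter (fun i => x i = true)).fold min hi v)

section Facts

variable {α β : Type*} [LinearOrder α] [LinearOrder β]

theorem IsBoxMap.monotone {m n : ℕ} {φ : (Fin m → Bool) → (Fin n → Bool)} (h : IsBoxMap φ) :
    Monotone φ := by
  induction h with
  | id n => exact monotone_id
  | comp _ _ h₁ h₂ => exact h₂.comp h₁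
  | face i ε =>
    intro x y hxy j
    refine Fin.succAboveCases i ?_ (fun j => ?_) j
    · simp [faceFun]
    · simpa [faceFun] using hxy j
  | degen i => exact fun x y hxy j => hxy _
  | conn i ε =>
    intro x y hxy j
    simp only [connFun]
    split_ifs
    · exact hxy _
    · exact min_le_min (hxy _) (hxy _)
    · exact max_le_max (hxy _) (hxy _)
    · exact hxy _

theorem lo_le_boxAct (lo hi : α) {k n : ℕ} (φ : (Fin k → Bool) → (Fin n → Bool))
    (v : Fin k → α) (j : Fin n) : lo ≤ boxAct lo hi φ v j :=
  (Finset.le_fold_max _).2 (Or.inl le_rfl)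

theorem boxAct_le_hi {lo hi : α} (h : lo ≤ hi) {k n : ℕ} (φ : (Fin k → Bool) → (Fin n → Bool))
    (v : Fin k → α) (j : Fin n) : boxAct lo hi φ v j ≤ hi :=
  (Finset.fold_max_le _).2 ⟨h, fun _ _ => ((Finset.le_fold_min _).1 le_rfl).1⟩

theorem le_boxAct_iff {lo hi s : α} (h₁ : lo < s) (h₂ : s ≤ hi) {k n : ℕ}
    {φ : (Fin k → Bool) → (Fin n → Bool)} (hφ : Monotone φ) (v : Fin k → α) (j : Fin n) :
    s ≤ boxAct lo hi φ v j ↔ φ (fun i => decide (s ≤ v i)) j = true := by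
  unfold boxAct
  rw [Finset.le_fold_max]
  constructor
  · rintro (h | ⟨x, hx, h⟩)
    · exact absurd h₁ (not_lt.2 h)
    · rw [Finset.le_fold_min] at h
      rw [Finset.mem_filter] at hx
      have hle : x ≤ fun i => decide (s ≤ v i) := by
        intro i
        by_cases hi : x i = true
        · have := h.2 i (by simp [hi])
          simp [this]
        · simp only [Bool.not_eq_true] at hi
          rw [hi]
          exact Bool.false_le _
      have := hφ hle j
      rw [hx.2] at this
      exact top_le_iff.1 this
  · intro h
    refine Or.inr ⟨_, by simpa using h, ?_⟩
    rw [Finset.le_fold_min]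
    exact ⟨h₂, fun i hi => by simpa using hi⟩

theorem eq_of_levels {lo hi a b : α} (ha : lo ≤ a) (ha' : a ≤ hi) (hb : lo ≤ b) (hb' : b ≤ hi)
    (h : ∀ s, lo < s → s ≤ hi → (s ≤ a ↔ s ≤ b)) : a = b := by
  apply le_antisymm
  · rcases ha.eq_or_lt with h' | h'
    · exact h' ▸ hb
    · exact (h a h' ha').1 le_rfl
  · rcases hb.eq_or_lt with h' | h'
    · exact h' ▸ ha
    · exact (h b h' hb').2 le_rfl

theorem le_clamp {lo hi : α} (a : α) : lo ≤ clamp lo hi a := le_max_left _ _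

theorem clamp_le {lo hi : α} (h : lo ≤ hi) (a : α) : clamp lo hi a ≤ hi :=
  max_le h (min_le_left _ _)

theorem le_clamp_iff {lo hi s : α} (h₁ : lo < s) (h₂ : s ≤ hi) (a : α) :
    s ≤ clamp lo hi a ↔ s ≤ a := by
  simp [clamp, h₁.not_ge, h₂]

theorem clamp_eq_self {lo hi a : α} (h₁ : lo ≤ a) (h₂ : a ≤ hi) : clamp lo hi a = a := by
  simp [clamp, h₁, h₂]

theorem boxAct_id {lo hi : α} (h : lo ≤ hi) {n : ℕ} (v : Fin n → α) :
    boxAct lo hi (fun x : Fin n → Bool => x) v = fun i => clamp lo hi (v i) := by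
  funext i
  refine eq_of_levels (lo_le_boxAct _ _ _ _ _) (boxAct_le_hi h _ _ _) (le_clamp _)
    (clamp_le h _) (fun s h₁ h₂ => ?_)
  rw [le_boxAct_iff h₁ h₂ (IsBoxMap.id n).monotone, le_clamp_iff h₁ h₂]
  simp

theorem boxAct_comp {lo hi : α} (h : lo ≤ hi) {k m n : ℕ} {φ : (Fin k → Bool) → (Fin m → Bool)}
    {ψ : (Fin m → Bool) → (Fin n → Bool)} (hφ : Monotone φ) (hψ : Monotone ψ) (v : Fin k → α) :
    boxAct lo hi (fun x => ψ (φ x)) v = boxAct lo hi ψ (boxAct lo hi φ v) := by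
  funext i
  refine eq_of_levels (lo_le_boxAct _ _ _ _ _) (boxAct_le_hi h _ _ _) (lo_le_boxAct _ _ _ _ _)
    (boxAct_le_hi h _ _ _) (fun s h₁ h₂ => ?_)
  rw [le_boxAct_iff h₁ h₂ (φ := fun x => ψ (φ x)) (hψ.comp hφ), le_boxAct_iff h₁ h₂ hψ]
  have : (fun i => decide (s ≤ boxAct lo hi φ v i)) = φ (fun i => decide (s ≤ v i)) := by
    funext j
    rw [Bool.eq_iff_iff, decide_eq_true_iff, le_boxAct_iff h₁ h₂ hφ]
  rw [this]

theorem boxAct_face {lo hi : α} (h : lo ≤ hi) {n : ℕ} (i : Fin (n + 1)) (ε : Bool)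
    (v : Fin n → α) :
    boxAct lo hi (faceFun (α := Bool) i ε) v
      = faceFun i (if ε then hi else lo) (fun j => clamp lo hi (v j)) := by
  funext j
  refine Fin.succAboveCases i ?_ (fun j => ?_) j
  · refine eq_of_levels (lo_le_boxAct _ _ _ _ _) (boxAct_le_hi h _ _ _)
      (hi := hi) (lo := lo) ?_ ?_ (fun s h₁ h₂ => ?_)
    · cases ε <;> simp [faceFun, h]
    · cases ε <;> simp [faceFun, h]
    · rw [le_boxAct_iff h₁ h₂ (IsBoxMap.face i ε).monotone]
      cases ε <;> simp [faceFun, h₁, h₂]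
  · refine eq_of_levels (lo_le_boxAct _ _ _ _ _) (boxAct_le_hi h _ _ _)
      (hi := hi) (lo := lo) ?_ ?_ (fun s h₁ h₂ => ?_)
    · simpa [faceFun] using le_clamp _
    · simpa [faceFun] using clamp_le h _
    · rw [le_boxAct_iff h₁ h₂ (IsBoxMap.face i ε).monotone]
      simp [faceFun, le_clamp_iff h₁ h₂]

theorem boxAct_degen {lo hi : α} (h : lo ≤ hi) {n : ℕ} (i : Fin (n + 1))
    (v : Fin (n + 1) → α) :
    boxAct lo hi (degenFun (α := Bool) i) v = degenFun i (fun j => clamp lo hi (v j)) := by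
  funext j
  refine eq_of_levels (lo_le_boxAct _ _ _ _ _) (boxAct_le_hi h _ _ _) (le_clamp _)
    (clamp_le h _) (fun s h₁ h₂ => ?_)
  rw [le_boxAct_iff h₁ h₂ (IsBoxMap.degen i).monotone]
  simp [degenFun, le_clamp_iff h₁ h₂]

theorem boxAct_conn {lo hi : α} (h : lo ≤ hi) {n : ℕ} (i : Fin (n + 1)) (ε : Bool)
    (v : Fin (n + 2) → α) :
    boxAct lo hi (connFun (α := Bool) i ε) v = connFun i ε (fun j => clamp lo hi (v j)) := by
  funext j
  refine eq_of_levels (lo_le_boxAct _ _ _ _ _) (boxAct_le_hi h _ _ _)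
      (hi := hi) (lo := lo) ?_ ?_ (fun s h₁ h₂ => ?_)
  · simp only [connFun]
    split_ifs <;> simp [le_clamp]
  · simp only [connFun]
    split_ifs <;> simp [clamp_le h]
  · rw [le_boxAct_iff h₁ h₂ (IsBoxMap.conn i ε).monotone]
    simp only [connFun]
    split_ifs <;> simp [le_clamp_iff h₁ h₂]

/-- Monotone maps that preserve the end points commute with the action of `φ`. -/
theorem map_boxAct {lo hi : α} {f : α → β} (hf : Monotone f) {k n : ℕ}
    (φ : (Fin k → Bool) → (Fin n → Bool)) (v : Fin k → α) :
    boxAct (f lo) (f hi) φ (fun i => f (v i)) = fun j => f (boxAct lo hi φ v j) := by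
  funext j
  have h₁ : ∀ x y, f (max x y) = max (f x) (f y) := fun x y => hf.map_max
  have h₂ : ∀ x y, f (min x y) = min (f x) (f y) := fun x y => hf.map_min
  unfold boxAct
  rw [← Finset.fold_hom (op := max) (op' := max) h₁]
  congr 1
  funext x
  exact Finset.fold_hom (op := min) (op' := min) h₂

theorem IsGraphMap.comp {U V W : Type*} {G : SimpleGraph U} {H : SimpleGraph V}
    {K : SimpleGraph W} {g : V → W} {f : U → V} (hg : IsGraphMap H K g) (hf : IsGraphMap G H f) :
    IsGraphMap G K (fun v => g (f v)) := by
  intro v w h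
  rcases hf h with h | h
  · exact hg h
  · exact Or.inr (congrArg g h)

/-- Coordinatewise application of a map of interval graphs. -/
theorem isGraphMap_pi {f : α → β}
    (hf : IsGraphMap (SimpleGraph.hasse α) (SimpleGraph.hasse β) f) (n : ℕ) :
    IsGraphMap (grid α n) (grid β n) (fun v i => f (v i)) := by
  rintro v w ⟨i, h, h'⟩
  rcases hf h with h | h
  · exact Or.inl ⟨i, h, fun j hj => congrArg f (h' j hj)⟩
  · refine Or.inr (funext fun j => ?_)
    by_cases hj : j = i
    · rw [hj]; exact h
    · exact congrArg f (h' j hj)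

theorem isGraphMap_of_covBy {f : α → β} (hf : ∀ a b : α, a ⋖ b → f a ⋖ f b ∨ f a = f b) :
    IsGraphMap (SimpleGraph.hasse α) (SimpleGraph.hasse β) f := by
  rintro a b (h | h)
  · rcases hf a b h with h | h
    · exact Or.inl (Or.inl h)
    · exact Or.inr h
  · rcases hf b a h with h | h
    · exact Or.inl (Or.inr h)
    · exact Or.inr h.symm

theorem isGraphMap_clamp (lo hi : α) :
    IsGraphMap (SimpleGraph.hasse α) (SimpleGraph.hasse α) (clamp lo hi) := by
  refine isGraphMap_of_covBy fun a b hab => ?_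
  rcases le_or_gt hi a with h₁ | h₁
  · right
    simp [clamp, h₁, h₁.trans hab.le]
  rcases le_or_gt b lo with h₂ | h₂
  · right
    simp [clamp, h₂, hab.le.trans h₂]
  · left
    rwa [clamp_eq_self (hab.le_of_lt h₂) h₁.le,
      clamp_eq_self h₂.le (hab.ge_of_gt h₁)]

theorem boxAct_clamp {lo hi : α} (h : lo ≤ hi) {k n : ℕ} {φ : (Fin k → Bool) → (Fin n → Bool)}
    (hφ : Monotone φ) (v : Fin k → α) :
    boxAct lo hi φ (fun i => clamp lo hi (v i)) = boxAct lo hi φ v := by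
  funext j
  refine eq_of_levels (lo_le_boxAct _ _ _ _ _) (boxAct_le_hi h _ _ _) (lo_le_boxAct _ _ _ _ _)
    (boxAct_le_hi h _ _ _) (fun s h₁ h₂ => ?_)
  rw [le_boxAct_iff h₁ h₂ hφ, le_boxAct_iff h₁ h₂ hφ]
  simp only [le_clamp_iff h₁ h₂]

theorem isGraphMap_max (c : α) :
    IsGraphMap (SimpleGraph.hasse α) (SimpleGraph.hasse α) (fun a => max a c) := by
  refine isGraphMap_of_covBy fun a b hab => ?_
  rcases le_or_gt c a with h | h
  · left
    rwa [max_eq_left h, max_eq_left (h.trans hab.le)]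
  · right
    rw [max_eq_right h.le, max_eq_right (hab.ge_of_gt h)]

theorem isGraphMap_min (c : α) :
    IsGraphMap (SimpleGraph.hasse α) (SimpleGraph.hasse α) (fun a => min a c) := by
  refine isGraphMap_of_covBy fun a b hab => ?_
  rcases le_or_gt b c with h | h
  · left
    rwa [min_eq_left h, min_eq_left (hab.le.trans h)]
  · right
    rw [min_eq_right h.le, min_eq_right (hab.le_of_lt h)]

theorem isGraphMap_connFun {n : ℕ} (i : Fin (n + 1)) (ε : Bool) :
    IsGraphMap (grid α (n + 2)) (grid α (n + 1)) (connFun i ε) := by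
  rintro v w ⟨j, hj, hj'⟩
  have main : ∀ l : Fin (n + 1), (∀ l', l' ≠ l → connFun i ε v l' = connFun i ε w l') →
      ((SimpleGraph.hasse α).Adj (connFun i ε v l) (connFun i ε w l) ∨
        connFun i ε v l = connFun i ε w l) →
      (grid α (n + 1)).Adj (connFun i ε v) (connFun i ε w) ∨ connFun i ε v = connFun i ε w := by
    intro l h₁ h₂
    rcases h₂ with h₂ | h₂
    · exact Or.inl ⟨l, h₂, h₁⟩
    · refine Or.inr (funext fun l' => ?_)
      by_cases hl : l' = l
      · rw [hl]; exact h₂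
      · exact h₁ l' hl
  have hne : ∀ l : Fin (n + 2), l.1 ≠ j.1 → v l = w l := fun l hl =>
    hj' l (fun e => hl (congrArg Fin.val e))
  have off : ∀ l' : Fin (n + 1), (l'.1 < i.1 → l'.1 ≠ j.1) →
      (l'.1 = i.1 → l'.1 ≠ j.1 ∧ l'.1 + 1 ≠ j.1) → (i.1 < l'.1 → l'.1 + 1 ≠ j.1) →
      connFun i ε v l' = connFun i ε w l' := by
    intro l' h₁ h₂ h₃
    rcases lt_trichotomy l'.1 i.1 with h | h | h
    · have : l' < i := h
      simp only [connFun, if_pos this]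
      exact hne _ (h₁ h)
    · have : l' = i := Fin.ext h
      subst this
      simp only [connFun, lt_irrefl, if_false, if_true]
      rw [hne l'.castSucc (h₂ rfl).1, hne l'.succ (by simpa using (h₂ rfl).2)]
    · have e₁ : ¬ l' < i := not_lt.2 (le_of_lt h)
      have e₂ : l' ≠ i := fun e => absurd h (by rw [e]; exact lt_irrefl _)
      simp only [connFun, if_neg e₁, if_neg e₂]
      exact hne _ (by simpa using h₃ h)
  rcases lt_or_ge j.1 i.1 with h | h
  · refine main ⟨j.1, by omega⟩ (fun l' hl' => off l' ?_ ?_ ?_) (Or.inl ?_)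
    · exact fun _ e => hl' (Fin.ext e)
    · omega
    · omega
    · have : (⟨j.1, by omega⟩ : Fin (n + 1)) < i := h
      simp only [connFun, if_pos this]
      exact hj
  rcases lt_or_ge (i.1 + 1) j.1 with h₂ | h₂
  · refine main ⟨j.1 - 1, by omega⟩ (fun l' hl' => off l' ?_ ?_ ?_) (Or.inl ?_)
    · omega
    · omega
    · exact fun _ e => hl' (Fin.ext (by simp only; omega))
    · have e₁ : ¬ (⟨j.1 - 1, by omega⟩ : Fin (n + 1)) < i := by
        rw [Fin.lt_def]; simp only; omega
      have e₂ : (⟨j.1 - 1, by omega⟩ : Fin (n + 1)) ≠ i := by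
        rw [Ne, Fin.ext_iff]; simp only; omega
      have e₃ : (⟨j.1 - 1, by omega⟩ : Fin (n + 1)).succ = j :=
        Fin.ext (by simp only [Fin.val_succ]; omega)
      simp only [connFun, if_neg e₁, if_neg e₂, e₃]
      exact hj
  · refine main i (fun l' hl' => off l' ?_ ?_ ?_) ?_
    · omega
    · exact fun e => absurd (Fin.ext e) hl'
    · omega
    · simp only [connFun, lt_irrefl, if_false, if_true]
      rcases h.eq_or_lt with e | e
      · have e₁ : i.castSucc = j := Fin.ext e
        have e₂ : v i.succ = w i.succ := hne _ (by simp only [Fin.val_succ]; omega)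
        rw [e₁, e₂]
        cases ε
        · exact isGraphMap_max _ hj
        · exact isGraphMap_min _ hj
      · have e₁ : i.succ = j := Fin.ext (by simp only [Fin.val_succ]; omega)
        have e₂ : v i.castSucc = w i.castSucc := hne _ (by simp only [Fin.val_castSucc]; omega)
        rw [e₁, e₂]
        cases ε
        · simpa [max_comm] using isGraphMap_max (w i.castSucc) hj
        · simpa [min_comm] using isGraphMap_min (w i.castSucc) hj

theorem isGraphMap_boxAct {lo hi : α} (h : lo ≤ hi) {k n : ℕ}
    {φ : (Fin k → Bool) → (Fin n → Bool)} (hφ : IsBoxMap φ) :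
    IsGraphMap (grid α k) (grid α n) (boxAct lo hi φ) := by
  induction hφ with
  | id n =>
    rw [funext (boxAct_id h (n := n))]
    exact isGraphMap_pi (isGraphMap_clamp lo hi) n
  | comp h₁ h₂ ih₁ ih₂ =>
    rw [funext (boxAct_comp h h₁.monotone h₂.monotone)]
    exact ih₂.comp ih₁
  | @face n i ε =>
    rw [funext (boxAct_face h i ε)]
    refine IsGraphMap.comp (g := faceFun i _) ?_ (isGraphMap_pi (isGraphMap_clamp lo hi) n)
    rintro v w ⟨j, hj, hj'⟩
    refine Or.inl ⟨i.succAbove j, by simpa [faceFun] using hj, fun l => ?_⟩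
    refine Fin.succAboveCases i (fun _ => by simp [faceFun]) (fun l hl => ?_) l
    have : l ≠ j := fun e => hl (by rw [e])
    simpa [faceFun] using hj' l this
  | @degen n i =>
    rw [funext (boxAct_degen h i)]
    refine IsGraphMap.comp (g := degenFun i) ?_ (isGraphMap_pi (isGraphMap_clamp lo hi) _)
    rintro v w ⟨j, hj, hj'⟩
    revert hj hj'
    refine Fin.succAboveCases i (fun _ hj' => ?_) (fun j hj hj' => ?_) j
    · exact Or.inr (funext fun l => hj' _ (Fin.succAbove_ne i l))
    · exact Or.inl ⟨j, hj, fun l hl => hj' _ (by simpa using hl)⟩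
  | @conn n i ε =>
    rw [funext (boxAct_conn h i ε)]
    refine IsGraphMap.comp (g := connFun i ε) ?_ (isGraphMap_pi (isGraphMap_clamp lo hi) _)
    exact isGraphMap_connFun i ε

end Facts

/-! ### Nerves of graphs -/

section Nerves

variable {V : Type u}

/-- The set `(N_m G)_n` of graph maps `I_m ^ n → G`. -/
def FiniteCube (m : ℕ) (G : SimpleGraph V) (n : ℕ) : Type u :=
  {f : (Fin n → Fin (m + 1)) → V // IsGraphMap (grid (Fin (m + 1)) n) G f}

/-- The `m`-nerve `N_m G` of a graph `G`. -/
def finiteNerve (m : ℕ) (G : SimpleGraph V) : CubicalSet.{u} where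
  obj b := FiniteCube m G b.unop.dim
  map φ := ↾fun f => ⟨fun v => f.1 (boxAct 0 (Fin.last m) φ.unop.1 v),
    f.2.comp (isGraphMap_boxAct (Fin.zero_le _) φ.unop.2)⟩
  map_id b := by
    ext f
    refine Subtype.ext (funext fun v => ?_)
    refine congrArg f.1 ((boxAct_id (Fin.zero_le _) v).trans (funext fun i => ?_))
    exact clamp_eq_self (Fin.zero_le _) (Fin.le_last _)
  map_comp φ ψ := by
    ext f
    refine Subtype.ext (funext fun v => ?_)
    exact congrArg f.1
      (boxAct_comp (Fin.zero_le _) ψ.unop.2.monotone φ.unop.2.monotone v)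

/-- The map `l : I_{m+1} → I_m`, `l 0 = 0` and `l v = v - 1` otherwise. -/
def lMap (m : ℕ) (v : Fin (m + 2)) : Fin (m + 1) := ⟨v.1 - 1, by omega⟩

/-- The map `r : I_{m+1} → I_m`, `r (m + 1) = m` and `r v = v` otherwise. -/
def rMap (m : ℕ) (v : Fin (m + 2)) : Fin (m + 1) := ⟨min v.1 m, by omega⟩

theorem isGraphMap_of_finCovBy {a b : ℕ} {f : Fin (a + 1) → Fin (b + 1)}
    (hf : ∀ x y : Fin (a + 1), x.1 + 1 = y.1 → (f x).1 + 1 = (f y).1 ∨ (f x).1 = (f y).1) :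
    IsGraphMap (SimpleGraph.hasse (Fin (a + 1))) (SimpleGraph.hasse (Fin (b + 1))) f := by
  refine isGraphMap_of_covBy fun x y h => ?_
  rw [Fin.covBy_iff, Nat.covBy_iff_add_one_eq] at h ⊢
  rcases hf x y h with h | h
  · exact Or.inl h
  · exact Or.inr (Fin.ext h)

/-- Precomposition with the `n`-th powers of a map `h : I_b → I_a` that preserves the order and
the end points. -/
def finitePrecomp {a b : ℕ} (G : SimpleGraph V) (h : Fin (b + 1) → Fin (a + 1))
    (hmono : Monotone h) (h0 : h 0 = 0) (h1 : h (Fin.last b) = Fin.last a)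
    (hg : IsGraphMap (SimpleGraph.hasse (Fin (b + 1))) (SimpleGraph.hasse (Fin (a + 1))) h) :
    finiteNerve a G ⟶ finiteNerve b G where
  app c := ↾fun f => ⟨fun v => f.1 (fun i => h (v i)), f.2.comp (isGraphMap_pi hg _)⟩
  naturality c d φ := by
    ext f
    refine Subtype.ext (funext fun v => ?_)
    refine congrArg f.1 ?_
    have := map_boxAct (lo := 0) (hi := Fin.last b) hmono φ.unop.1 v
    rw [h0, h1] at this
    exact this

/-- The map `l^* : N_m G → N_{m+1} G`. -/
def lStar (m : ℕ) (G : SimpleGraph V) : finiteNerve m G ⟶ finiteNerve (m + 1) G :=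
  finitePrecomp G (lMap m)
    (fun x y (hxy : x.1 ≤ y.1) => show x.1 - 1 ≤ y.1 - 1 by omega)
    (Fin.ext (by simp [lMap])) (Fin.ext (by simp [lMap]))
    (isGraphMap_of_finCovBy fun x y h => by simp only [lMap]; omega)

/-- The map `r^* : N_m G → N_{m+1} G`. -/
def rStar (m : ℕ) (G : SimpleGraph V) : finiteNerve m G ⟶ finiteNerve (m + 1) G :=
  finitePrecomp G (rMap m)
    (fun x y (hxy : x.1 ≤ y.1) => show min x.1 m ≤ min y.1 m by omega)
    (Fin.ext (by simp [rMap])) (Fin.ext (by simp [rMap]))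
    (isGraphMap_of_finCovBy fun x y h => by simp only [rMap]; omega)

/-- `f : I_∞ ^ n → V` is stable in direction `(i, ε)`: there is `M ≥ 0` such that
`f (v₁, …, (2ε - 1) t, …, vₙ) = f (v₁, …, (2ε - 1) M, …, vₙ)` for all `t > M`. -/
def IsStableIn {n : ℕ} (f : (Fin n → ℤ) → V) (i : Fin n) (ε : Bool) : Prop :=
  ∃ M : ℕ, ∀ (v : Fin n → ℤ) (t : ℤ), (M : ℤ) < t →
    f (Function.update v i ((if ε then 1 else -1) * t))
      = f (Function.update v i ((if ε then 1 else -1) * (M : ℤ)))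

/-- The set `(N G)_n` of graph maps `I_∞ ^ n → G` that are stable in all directions. -/
def StableCube (G : SimpleGraph V) (n : ℕ) : Type u :=
  {f : (Fin n → ℤ) → V //
    IsGraphMap (grid ℤ n) G f ∧ ∀ (i : Fin n) (ε : Bool), IsStableIn f i ε}

/-- `f` only depends on the coordinates truncated to `[-M, M]`. -/
def BoundedBy {n : ℕ} (f : (Fin n → ℤ) → V) (M : ℕ) : Prop :=
  ∀ v, f (fun i => clamp (-(M : ℤ)) M (v i)) = f v

theorem BoundedBy.isStableIn {n : ℕ} {f : (Fin n → ℤ) → V} {M : ℕ} (h : BoundedBy f M)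
    (i : Fin n) (ε : Bool) : IsStableIn f i ε := by
  refine ⟨M, fun v t ht => ?_⟩
  rw [← h, ← h (Function.update v i _)]
  refine congrArg f (funext fun j => ?_)
  by_cases hj : j = i
  · subst hj
    cases ε <;> simp [clamp] <;> omega
  · simp [Function.update_of_ne hj]

theorem exists_boundedBy {n : ℕ} {f : (Fin n → ℤ) → V}
    (h : ∀ (i : Fin n) (ε : Bool), IsStableIn f i ε) : ∃ M : ℕ, BoundedBy f M := by
  choose B hB using h
  let M : ℕ := Finset.univ.sup (fun p : Fin n × Bool => B p.1 p.2)
  have hM : ∀ i ε, (B i ε : ℤ) ≤ M := fun i ε => by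
    exact_mod_cast Finset.le_sup (f := fun p : Fin n × Bool => B p.1 p.2) (Finset.mem_univ (i, ε))
  have key : ∀ (i : Fin n) (v : Fin n → ℤ),
      f (Function.update v i (clamp (-(M : ℤ)) M (v i))) = f v := by
    intro i v
    have ht := hM i true
    have hf := hM i false
    rcases lt_or_ge (M : ℤ) (v i) with h₁ | h₁
    · have e₁ := hB i true v (v i) (by omega)
      have e : clamp (-(M : ℤ)) M (v i) = M := by simp only [clamp]; omega
      rw [e]
      simp only [if_true, one_mul, Function.update_eq_self] at e₁
      rcases ht.eq_or_lt with h₂ | h₂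
      · rw [e₁, h₂]
      · have e₂ := hB i true v M h₂
        simp only [if_true, one_mul] at e₂
        rw [e₁, e₂]
    · rcases lt_or_ge (v i) (-(M : ℤ)) with h₂ | h₂
      · have e₁ := hB i false v (-(v i)) (by omega)
        have e : clamp (-(M : ℤ)) M (v i) = -M := by simp only [clamp]; omega
        rw [e]
        simp only [Bool.false_eq_true, if_false, neg_mul, one_mul, neg_neg,
          Function.update_eq_self] at e₁
        rcases hf.eq_or_lt with h₃ | h₃
        · rw [e₁, h₃]
        · have e₂ := hB i false v M h₃
          simp only [Bool.false_eq_true, if_false, neg_mul, one_mul] at e₂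
          rw [e₁, e₂]
      · rw [clamp_eq_self h₂ h₁, Function.update_eq_self]
  refine ⟨M, fun v => ?_⟩
  have main : ∀ S : Finset (Fin n),
      f (fun i => if i ∈ S then clamp (-(M : ℤ)) M (v i) else v i) = f v := by
    intro S
    induction S using Finset.induction_on with
    | empty => simp
    | @insert a S ha ih =>
      rw [← ih, ← key a (fun i => if i ∈ S then clamp (-(M : ℤ)) M (v i) else v i)]
      refine congrArg f (funext fun j => ?_)
      by_cases hj : j = a
      · subst hj; simp [ha]
      · simp [hj]
  simpa using main Finset.univ

/-- A bound for the size of a stable map. -/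
noncomputable def StableCube.bound {G : SimpleGraph V} {n : ℕ} (f : StableCube G n) : ℕ :=
  (exists_boundedBy f.2.2).choose

theorem StableCube.boundedBy {G : SimpleGraph V} {n : ℕ} (f : StableCube G n) :
    BoundedBy f.1 f.bound :=
  (exists_boundedBy f.2.2).choose_spec

theorem neg_cast_le (M : ℕ) : -(M : ℤ) ≤ M := by omega

/-- The restriction of a bounded map along `φ`, computed with any bound, is the same. -/
theorem BoundedBy.apply_boxAct {n k : ℕ} {f : (Fin n → ℤ) → V} {M K : ℕ} (hM : BoundedBy f M)
    (hK : BoundedBy f K) {φ : (Fin k → Bool) → (Fin n → Bool)} (hφ : Monotone φ)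
    (v : Fin k → ℤ) :
    f (boxAct (-(M : ℤ)) M φ v) = f (boxAct (-(K : ℤ)) K φ v) := by
  wlog h : M ≤ K generalizing M K
  · exact (this hK hM (by omega)).symm
  have hmono : Monotone (clamp (-(M : ℤ)) M) := fun x y hxy => by simp only [clamp]; omega
  have := map_boxAct (lo := -(K : ℤ)) (hi := K) hmono φ v
  have e₁ : clamp (-(M : ℤ)) M (-(K : ℤ)) = -M := by simp only [clamp]; omega
  have e₂ : clamp (-(M : ℤ)) M (K : ℤ) = M := by simp only [clamp]; omega
  rw [e₁, e₂, boxAct_clamp (neg_cast_le M) hφ] at this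
  rw [← hM (boxAct (-(K : ℤ)) K φ v), ← this]

theorem BoundedBy.restrict {n k : ℕ} {f : (Fin n → ℤ) → V} {M : ℕ} (_ : BoundedBy f M)
    {φ : (Fin k → Bool) → (Fin n → Bool)} (hφ : Monotone φ) :
    BoundedBy (fun v => f (boxAct (-(M : ℤ)) M φ v)) M :=
  fun v => congrArg f (boxAct_clamp (neg_cast_le M) hφ v)

/-- The nerve `N G` of a graph `G`. The restriction of a stable map `f` along `φ` is
`v ↦ f (φ v)`, where `φ` acts on tuples of integers with `-M` and `M` in the roles of `0`
and `1`, for any `M` beyond which `f` is stable. -/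
noncomputable def nerve (G : SimpleGraph V) : CubicalSet.{u} where
  obj b := StableCube G b.unop.dim
  map φ := ↾fun f => ⟨fun v => f.1 (boxAct (-(f.bound : ℤ)) f.bound φ.unop.1 v),
    f.2.1.comp (isGraphMap_boxAct (neg_cast_le _) φ.unop.2),
    fun i ε => (f.boundedBy.restrict φ.unop.2.monotone).isStableIn i ε⟩
  map_id b := by
    ext f
    refine Subtype.ext (funext fun v => ?_)
    exact (congrArg f.1 (boxAct_id (neg_cast_le _) v)).trans (f.boundedBy v)
  map_comp {b c d} φ ψ := by
    ext f
    refine Subtype.ext (funext fun v => ?_)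
    refine (congrArg f.1
      (boxAct_comp (neg_cast_le _) ψ.unop.2.monotone φ.unop.2.monotone v)).trans ?_
    let g : StableCube G c.unop.dim :=
      ⟨fun v => f.1 (boxAct (-(f.bound : ℤ)) f.bound φ.unop.1 v),
        f.2.1.comp (isGraphMap_boxAct (neg_cast_le _) φ.unop.2),
        fun i ε => (f.boundedBy.restrict φ.unop.2.monotone).isStableIn i ε⟩
    exact (f.boundedBy.restrict φ.unop.2.monotone).apply_boxAct g.boundedBy
      ψ.unop.2.monotone v

/-- The action of the box category on `N G` may be computed with any bound. -/
theorem nerve_map_apply (G : SimpleGraph V) {b c : Boxᵒᵖ} (φ : b ⟶ c) (f : (nerve G).obj b)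
    {M : ℕ} (hM : BoundedBy f.1 M) (v : Fin c.unop.dim → ℤ) :
    ((nerve G).map φ f).1 v = f.1 (boxAct (-(M : ℤ)) M φ.unop.1 v) :=
  BoundedBy.apply_boxAct (StableCube.boundedBy f) hM φ.unop.2.monotone v

/-- The map `I_∞ → I_m` that shifts by `⌊m / 2⌋` and truncates to `[0, m]`, so that it maps the
interval `[-⌊m / 2⌋, m - ⌊m / 2⌋]` isomorphically to `I_m`. -/
def collapse (m : ℕ) (t : ℤ) : Fin (m + 1) :=
  ⟨(clamp 0 (m : ℤ) (t + (m / 2 : ℕ))).toNat, by simp only [clamp]; omega⟩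

theorem collapse_val (m : ℕ) (t : ℤ) :
    ((collapse m t).1 : ℤ) = clamp 0 (m : ℤ) (t + (m / 2 : ℕ)) := by
  simp only [collapse, clamp]; omega

theorem collapse_mono (m : ℕ) : Monotone (collapse m) := fun x y h => by
  rw [Fin.le_def, ← Int.ofNat_le, collapse_val, collapse_val]
  simp only [clamp]; omega

theorem isGraphMap_collapse (m : ℕ) :
    IsGraphMap (SimpleGraph.hasse ℤ) (SimpleGraph.hasse (Fin (m + 1))) (collapse m) := by
  refine isGraphMap_of_covBy fun x y h => ?_
  rw [Order.covBy_iff_add_one_eq] at h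
  rw [Fin.covBy_iff, Nat.covBy_iff_add_one_eq, Fin.ext_iff]
  have h₁ := collapse_val m x
  have h₂ := collapse_val m y
  simp only [clamp] at h₁ h₂
  omega

theorem collapse_clamp (m : ℕ) (t : ℤ) : collapse m (clamp (-(m : ℤ)) m t) = collapse m t := by
  rw [Fin.ext_iff, ← Int.ofNat_inj, collapse_val, collapse_val]
  simp only [clamp]; omega

theorem boundedBy_collapse {m n : ℕ} (f : (Fin n → Fin (m + 1)) → V) :
    BoundedBy (fun v => f (fun i => collapse m (v i))) m :=
  fun v => congrArg f (funext fun i => collapse_clamp m (v i))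

/-- The inclusion `N_m G → N G` that regards `I_m` as the interval
`[-⌊m / 2⌋, m - ⌊m / 2⌋]` of `I_∞` and extends maps by truncation. -/
noncomputable def nerveIncl (m : ℕ) (G : SimpleGraph V) : finiteNerve m G ⟶ nerve G where
  app c := ↾fun f => ⟨fun v => f.1 (fun i => collapse m (v i)),
    f.2.comp (isGraphMap_pi (isGraphMap_collapse m) _),
    fun i ε => BoundedBy.isStableIn (M := m) (boundedBy_collapse f.1) i ε⟩
  naturality c d φ := by
    ext f
    refine Subtype.ext (funext fun v => ?_)
    refine Eq.trans ?_ (nerve_map_apply G φ _ (M := m) (boundedBy_collapse f.1) v).symm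
    refine congrArg f.1 ?_
    have := map_boxAct (lo := -(m : ℤ)) (hi := m) (collapse_mono m) φ.unop.1 v
    have e₁ : collapse m (-(m : ℤ)) = 0 := by
      rw [Fin.ext_iff, ← Int.ofNat_inj, collapse_val]; simp only [clamp, Fin.val_zero]; omega
    have e₂ : collapse m (m : ℤ) = Fin.last m := by
      rw [Fin.ext_iff, ← Int.ofNat_inj, collapse_val]; simp only [clamp, Fin.val_last]; omega
    rw [e₁, e₂] at this
    exact this

/-- The sequence `N_1 G → N_2 G → N_3 G → N_4 G → ⋯` with alternating maps `l^*, r^*, l^*, …`;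
its value at `k` is `N_{k+1} G`. -/
noncomputable def nerveSequence (G : SimpleGraph V) : ℕ ⥤ CubicalSet.{u} :=
  Functor.ofSequence (X := fun k => finiteNerve (k + 1) G)
    (fun k => if Even k then lStar (k + 1) G else rStar (k + 1) G)

theorem nerveSequence_comm (G : SimpleGraph V) (k : ℕ) :
    (if Even k then lStar (k + 1) G else rStar (k + 1) G) ≫ nerveIncl (k + 2) G
      = nerveIncl (k + 1) G := by
  ext c f
  refine Subtype.ext (funext fun v => ?_)
  split_ifs with h
  · refine congrArg f.1 (funext fun i => ?_)
    change lMap (k + 1) (collapse (k + 2) (v i)) = collapse (k + 1) (v i)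
    have h₁ := collapse_val (k + 1) (v i)
    have h₂ := collapse_val (k + 2) (v i)
    obtain ⟨j, rfl⟩ := h
    simp only [clamp] at h₁ h₂
    rw [Fin.ext_iff]
    simp only [lMap]
    omega
  · refine congrArg f.1 (funext fun i => ?_)
    change rMap (k + 1) (collapse (k + 2) (v i)) = collapse (k + 1) (v i)
    have h₁ := collapse_val (k + 1) (v i)
    have h₂ := collapse_val (k + 2) (v i)
    obtain ⟨j, rfl⟩ := Nat.not_even_iff_odd.1 h
    simp only [clamp] at h₁ h₂
    rw [Fin.ext_iff]
    simp only [rMap]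
    omega

/-- The cocone on the sequence of finite nerves with the inclusions `N_m G → N G` as legs. -/
noncomputable def nerveCocone (G : SimpleGraph V) : Limits.Cocone (nerveSequence G) where
  pt := nerve G
  ι := NatTrans.ofSequence (fun k => nerveIncl (k + 1) G) (fun k => by
    refine Eq.trans ?_ (Category.comp_id _).symm
    refine Eq.trans ?_ (nerveSequence_comm G k)
    exact congrArg (· ≫ nerveIncl (k + 2) G) (Functor.ofSequence_map_homOfLE_succ _ k))

end Nerves

end DiscreteCubical

/-! Kan property. Choose `M > 0` such that all given faces of an open box are constant outside `[-M,
M]`. There is a retraction `openBoxRetract` of the integer grid onto the open box in the boundary of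
`[-M, M]^(n+1)`: it truncates every coordinate, and in the direction of the missing face it keeps
the point on the opposite face until the distance of the other coordinates from `[-M, M]` allows it
to leave. Adjacent points go to near points of a common face (`exists_common_face`), so composing
with the given faces yields a graph map. It is bounded by `3 * M` and has the prescribed faces.

Colimit. The maps into the nerve are injective, and a map bounded by `M` already comes from
`I_(2M+1)`. Hence the inclusion of the first nerve is an ω-composition of maps `l^*` and `r^*`.

Anodyne maps. The image of `l^*` or `r^*` consists of the cubes that do not change when one end of
`I_(m+1)`, selected by `δ`, is moved to its neighbour in any coordinate. The other cubes are
attached along open boxes. Given a cube `f`, let `cutoff` be the least `c` such that pushing all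
coordinates from the `c`-th on inward is a homotopy of length one. This homotopy is a cube `maxCyl δ
f` of one dimension more, with `f` as its face in the last direction at `δ`. Choosing `f` outside
the current subobject with minimal (number of unstable directions, dimension, cutoff) puts all other
faces of `maxCyl δ f` into the subobject: the opposite face has fewer unstable directions, and the
remaining faces are smaller or are again of the form `maxCyl δ g` with `g` already present. So `f`
and `maxCyl δ f` are attached together (`exists_larger_subfunctor`).

For this to be a pushout, the attached cubes must be nondegenerate and their degeneracies must be
distinct. The latter is the uniqueness half of the Eilenberg–Zilber lemma (`Nondeg.eq_of_map_eq`).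
That the subobject stays closed under `maxCyl` rests on the compatibility of `maxCyl` with
degeneracies and connections, which is why the cutoff has to be the least possible. -/

namespace DiscreteCubical

/-! ### Combinatorics of the box category -/

section Operators

variable {α : Type*} {n : ℕ}

theorem faceFun_self (i : Fin (n + 1)) (c : α) (x : Fin n → α) : faceFun i c x i = c := by
  simp [faceFun]

theorem faceFun_succAbove (i : Fin (n + 1)) (c : α) (x : Fin n → α) (j : Fin n) :
    faceFun i c x (i.succAbove j) = x j := by
  simp [faceFun]

theorem degenFun_faceFun (i : Fin (n + 1)) (c : α) (x : Fin n → α) :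
    degenFun i (faceFun i c x) = x :=
  funext fun j => faceFun_succAbove i c x j

theorem faceFun_degenFun (i : Fin (n + 1)) (x : Fin (n + 1) → α) :
    faceFun i (x i) (degenFun i x) = x := by
  funext j
  refine Fin.succAboveCases i ?_ (fun j => ?_) j
  · exact faceFun_self _ _ _
  · exact faceFun_succAbove _ _ _ _

theorem faceFun_apply (i : Fin (n + 1)) (c : α) (x : Fin n → α) (j : Fin (n + 1)) :
    faceFun i c x j = if h : j.1 < i.1 then x ⟨j.1, by omega⟩
      else if h' : j.1 = i.1 then c else x ⟨j.1 - 1, by omega⟩ := by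
  refine Fin.succAboveCases i ?_ (fun j => ?_) j
  · simp [faceFun_self]
  · rw [faceFun_succAbove]
    simp only [Fin.succAbove, Fin.lt_def]
    grind

theorem degenFun_apply (i : Fin (n + 1)) (x : Fin (n + 1) → α) (j : Fin n) :
    degenFun i x j = if j.1 < i.1 then x ⟨j.1, by omega⟩ else x ⟨j.1 + 1, by omega⟩ := by
  simp only [degenFun, Fin.succAbove, Fin.lt_def, Fin.val_castSucc]
  split_ifs <;> rfl

variable [LinearOrder α]

/-- The operation (`max` if `ε = false`, `min` if `ε = true`) of a connection. -/
def connOp (ε : Bool) (a b : α) : α := if ε then min a b else max a b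

theorem connFun_apply (i : Fin (n + 1)) (ε : Bool) (x : Fin (n + 2) → α) (j : Fin (n + 1)) :
    connFun i ε x j = if j.1 < i.1 then x ⟨j.1, by omega⟩
      else if j.1 = i.1 then connOp ε (x ⟨j.1, by omega⟩) (x ⟨j.1 + 1, by omega⟩)
      else x ⟨j.1 + 1, by omega⟩ := by
  simp only [connFun, connOp, Fin.lt_def, Fin.ext_iff]
  split_ifs <;> rfl

end Operators

theorem degenFun_faceFun_of_ne {α : Type*} {n : ℕ} {i j : Fin (n + 2)} (h : i ≠ j) :
    ∃ i' j' : Fin (n + 1), ∀ (c : α) (x : Fin (n + 1) → α),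
      degenFun i (faceFun j c x) = faceFun j' c (degenFun i' x) := by
  rw [Ne, Fin.ext_iff] at h
  refine ⟨⟨if i.1 < j.1 then i.1 else i.1 - 1, by grind⟩,
    ⟨if i.1 < j.1 then j.1 - 1 else j.1, by grind⟩, fun c x => funext fun l => ?_⟩
  simp only [degenFun_apply, faceFun_apply]
  grind

theorem connFun_faceFun_of_ne {α : Type*} [LinearOrder α] {n : ℕ} {i : Fin (n + 2)} (ε : Bool)
    {j : Fin (n + 3)} (h : j ≠ i.castSucc) (h' : j ≠ i.succ) :
    ∃ (i' : Fin (n + 1)) (j' : Fin (n + 2)), ∀ (c : α) (x : Fin (n + 2) → α),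
      connFun i ε (faceFun j c x) = faceFun j' c (connFun i' ε x) := by
  rw [Ne, Fin.ext_iff, Fin.val_castSucc] at h
  rw [Ne, Fin.ext_iff, Fin.val_succ] at h'
  refine ⟨⟨if i.1 < j.1 then i.1 else i.1 - 1, by grind⟩,
    ⟨if i.1 < j.1 then j.1 - 1 else j.1, by grind⟩, fun c x => funext fun l => ?_⟩
  simp only [connFun_apply, faceFun_apply]
  grind

theorem connOp_bool_left (ε a : Bool) : connOp ε ε a = a := by revert ε a; decide

theorem connOp_bool_right (ε a : Bool) : connOp ε a ε = a := by revert ε a; decide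

theorem connOp_bool_not_left (ε a : Bool) : connOp ε (!ε) a = !ε := by revert ε a; decide

theorem connOp_bool_not_right (ε a : Bool) : connOp ε a (!ε) = !ε := by revert ε a; decide

/-- The inserted end point `ε` is neutral for the operation of the connection. -/
theorem connFun_faceFun_eq {n : ℕ} {i : Fin (n + 1)} (ε : Bool)
    {j : Fin (n + 2)} (h : j = i.castSucc ∨ j = i.succ) (x : Fin (n + 1) → Bool) :
    connFun i ε (faceFun j ε x) = x := by
  have h : j.1 = i.1 ∨ j.1 = i.1 + 1 := by rcases h with rfl | rfl <;> simp
  funext l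
  simp only [connFun_apply, faceFun_apply]
  grind [connOp_bool_left, connOp_bool_right]

/-- The inserted end point is absorbing for the operation of the connection, so the neighbouring
coordinate is forgotten. -/
theorem connFun_faceFun_not {n : ℕ} {i : Fin (n + 1)} {ε η : Bool} (hη : η ≠ ε)
    {j : Fin (n + 2)} (h : j = i.castSucc ∨ j = i.succ) (x : Fin (n + 1) → Bool) :
    connFun i ε (faceFun j η x) = faceFun i η (degenFun i x) := by
  have h : j.1 = i.1 ∨ j.1 = i.1 + 1 := by rcases h with rfl | rfl <;> simp
  obtain rfl : η = !ε := by cases η <;> cases ε <;> simp_all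
  funext l
  simp only [connFun_apply, faceFun_apply, degenFun_apply]
  grind [connOp_bool_not_left, connOp_bool_not_right]

/-! ### Box maps are composites of degeneracies and connections, or land in a proper face -/

namespace Box

/-- The degeneracy `[1]^(n+1) ⟶ [1]^n`. -/
def degen {n : ℕ} (i : Fin (n + 1)) : Box.mk (n + 1) ⟶ Box.mk n :=
  ⟨degenFun i, IsBoxMap.degen i⟩

/-- The connection `[1]^(n+2) ⟶ [1]^(n+1)`. -/
def conn {n : ℕ} (i : Fin (n + 1)) (ε : Bool) : Box.mk (n + 2) ⟶ Box.mk (n + 1) :=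
  ⟨connFun i ε, IsBoxMap.conn i ε⟩

theorem hom_ext {a b : Box} {φ ψ : a ⟶ b} (h : ∀ x, φ.1 x = ψ.1 x) : φ = ψ :=
  Subtype.ext (funext h)

theorem face_degen {n : ℕ} (i : Fin (n + 1)) (ε : Bool) : face i ε ≫ degen i = 𝟙 _ :=
  hom_ext fun x => degenFun_faceFun i ε x

/-- The composites of degeneracies and connections. -/
inductive IsDegen : ∀ {m n : ℕ}, (Box.mk m ⟶ Box.mk n) → Prop
  | id (n : ℕ) : IsDegen (𝟙 (Box.mk n))
  | degen {m n : ℕ} (i : Fin (m + 1)) {φ : Box.mk m ⟶ Box.mk n} :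
      IsDegen φ → IsDegen (degen i ≫ φ)
  | conn {m n : ℕ} (i : Fin (m + 1)) (ε : Bool) {φ : Box.mk (m + 1) ⟶ Box.mk n} :
      IsDegen φ → IsDegen (conn i ε ≫ φ)

/-- `φ` maps to a proper face. -/
def HasConst {m n : ℕ} (φ : Box.mk m ⟶ Box.mk n) : Prop :=
  ∃ (j : Fin n) (c : Bool), ∀ x, φ.1 x j = c

theorem HasConst.comp {k m n : ℕ} {φ : Box.mk m ⟶ Box.mk n} (h : HasConst φ)
    (ψ : Box.mk k ⟶ Box.mk m) : HasConst (ψ ≫ φ) := by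
  obtain ⟨j, c, h⟩ := h
  exact ⟨j, c, fun x => h _⟩

theorem eq_comp_face {m n : ℕ} {φ : Box.mk m ⟶ Box.mk (n + 1)} {j : Fin (n + 1)} {c : Bool}
    (h : ∀ x, φ.1 x j = c) : φ = (φ ≫ degen j) ≫ face j c := by
  refine hom_ext fun x => ?_
  have := faceFun_degenFun j (φ.1 x)
  rw [h x] at this
  exact this.symm

/-- The face maps, as a predicate. -/
inductive IsFace : ∀ {m n : ℕ}, (Box.mk m ⟶ Box.mk n) → Prop
  | mk {n : ℕ} (i : Fin (n + 1)) (ε : Bool) : IsFace (face i ε)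

/-- The face is moved to the right past one generator at a time by the cubical identities. It either
cancels against a generator or survives to the end, and then it makes a coordinate constant. -/
theorem IsDegen.face_comp {m n : ℕ} {φ : Box.mk m ⟶ Box.mk n} (h : IsDegen φ) :
    ∀ {k : ℕ} {ψ : Box.mk k ⟶ Box.mk m}, IsFace ψ → IsDegen (ψ ≫ φ) ∨ HasConst (ψ ≫ φ) := by
  induction h with
  | id n =>
    rintro k _ ⟨i, ε⟩
    exact Or.inr ⟨i, ε, fun x => faceFun_self i ε x⟩
  | @degen m n i φ h ih =>
    rintro k _ ⟨j, ε⟩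
    by_cases hij : i = j
    · subst hij
      left
      rwa [← Category.assoc, face_degen, Category.id_comp]
    · obtain _ | m := m
      · exact absurd (Subsingleton.elim (α := Fin 1) i j) hij
      obtain ⟨i', j', h'⟩ := degenFun_faceFun_of_ne (α := Bool) hij
      have e : Box.face j ε ≫ Box.degen i ≫ φ = Box.degen i' ≫ Box.face j' ε ≫ φ :=
        hom_ext fun x => congrArg φ.1 (h' ε x)
      rw [e]
      exact (ih (.mk j' ε)).imp (.degen i') (fun h => h.comp _)
  | @conn m n i δ φ h ih =>
    rintro k _ ⟨j, ε⟩
    by_cases hij : j = i.castSucc ∨ j = i.succ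
    · by_cases hε : ε = δ
      · subst hε
        have e : Box.face j ε ≫ Box.conn i ε ≫ φ = φ :=
          hom_ext fun x => congrArg φ.1 (connFun_faceFun_eq ε hij x)
        rw [e]
        exact Or.inl h
      · have e : Box.face j ε ≫ Box.conn i δ ≫ φ = Box.degen i ≫ Box.face i ε ≫ φ :=
          hom_ext fun x => congrArg φ.1 (connFun_faceFun_not hε hij x)
        rw [e]
        exact (ih (.mk i ε)).imp (.degen i) (fun h => h.comp _)
    · rw [not_or] at hij
      obtain _ | m := m
      · exfalso
        have h₁ : j.1 ≠ i.1 := fun e => hij.1 (Fin.ext e)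
        have h₂ : j.1 ≠ i.1 + 1 := fun e => hij.2 (Fin.ext e)
        omega
      obtain ⟨i', j', h'⟩ := connFun_faceFun_of_ne (α := Bool) δ hij.1 hij.2
      have e : Box.face j ε ≫ Box.conn i δ ≫ φ = Box.conn i' δ ≫ Box.face j' ε ≫ φ :=
        hom_ext fun x => congrArg φ.1 (h' ε x)
      rw [e]
      exact (ih (.mk j' ε)).imp (.conn i' δ) (fun h => h.comp _)

/-- The arbitrary map `φ` composed on the right makes the case of a composite in the induction
immediate. -/
theorem isDegen_or_hasConst_comp {m n : ℕ} {f : (Fin m → Bool) → (Fin n → Bool)}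
    (hf : IsBoxMap f) : ∀ {k : ℕ} {φ : Box.mk n ⟶ Box.mk k}, IsDegen φ ∨ HasConst φ →
      IsDegen ((⟨f, hf⟩ : Box.mk m ⟶ Box.mk n) ≫ φ) ∨
      HasConst ((⟨f, hf⟩ : Box.mk m ⟶ Box.mk n) ≫ φ) := by
  induction hf with
  | id n => exact fun h => h
  | comp h₁ h₂ ih₁ ih₂ => exact fun h => ih₁ (ih₂ h)
  | face i ε => exact fun h => h.elim (fun h => h.face_comp (.mk i ε)) (fun h => .inr (h.comp _))
  | degen i => exact fun h => h.imp (.degen i) (fun h => h.comp _)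
  | conn i ε => exact fun h => h.imp (.conn i ε) (fun h => h.comp _)

theorem isDegen_or_hasConst {m n : ℕ} (φ : Box.mk m ⟶ Box.mk n) : IsDegen φ ∨ HasConst φ :=
  isDegen_or_hasConst_comp φ.2 (φ := 𝟙 (Box.mk n)) (.inl (.id n))

theorem face_conn {n : ℕ} (i : Fin (n + 1)) (ε : Bool) {j : Fin (n + 2)}
    (h : j = i.castSucc ∨ j = i.succ) : face j ε ≫ conn i ε = 𝟙 _ :=
  hom_ext fun x => connFun_faceFun_eq ε h x

theorem IsDegen.exists_section {m n : ℕ} {φ : Box.mk m ⟶ Box.mk n} (h : IsDegen φ) :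
    ∃ s : Box.mk n ⟶ Box.mk m, s ≫ φ = 𝟙 _ := by
  induction h with
  | id n => exact ⟨𝟙 _, Category.id_comp _⟩
  | @degen m n i φ h ih =>
    obtain ⟨s, hs⟩ := ih
    refine ⟨s ≫ Box.face i true, ?_⟩
    rw [Category.assoc, ← Category.assoc (Box.face i true), face_degen, Category.id_comp, hs]
  | @conn m n i ε φ h ih =>
    obtain ⟨s, hs⟩ := ih
    refine ⟨s ≫ Box.face i.castSucc ε, ?_⟩
    rw [Category.assoc, ← Category.assoc (Box.face i.castSucc ε), face_conn i ε (.inl rfl),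
      Category.id_comp, hs]

theorem IsDegen.lt_or_eq {m n : ℕ} {φ : Box.mk m ⟶ Box.mk n} (h : IsDegen φ) :
    n < m ∨ ∃ h : n = m, ∀ x j, φ.1 x j = x (Fin.cast h j) := by
  induction h with
  | id n => exact Or.inr ⟨rfl, fun x j => rfl⟩
  | degen i h ih => rcases ih with ih | ⟨ih, -⟩ <;> exact Or.inl (by omega)
  | conn i ε h ih => rcases ih with ih | ⟨ih, -⟩ <;> exact Or.inl (by omega)

theorem IsDegen.eq_id {n : ℕ} {φ : Box.mk n ⟶ Box.mk n} (h : IsDegen φ) : φ = 𝟙 _ := by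
  obtain h | ⟨_, h⟩ := h.lt_or_eq
  · exact absurd h (lt_irrefl n)
  · exact hom_ext fun x => funext fun j => h x j

end Box

/-! ### Nondegenerate cubes and the uniqueness half of the Eilenberg–Zilber lemma -/

/-- The set of `n`-cubes of a cubical set. -/
abbrev Cubes (X : CubicalSet.{u}) (n : ℕ) : Type u := X.obj (op (Box.mk n))

/-- A cube is nondegenerate if it is not a restriction of a cube of smaller dimension. -/
def Nondeg {X : CubicalSet.{u}} {n : ℕ} (x : Cubes X n) : Prop :=
  ∀ k < n, ∀ (z : Cubes X k) (φ : Box.mk n ⟶ Box.mk k), X.map φ.op z ≠ x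

theorem cubes_map_comp (X : CubicalSet.{u}) {k m n : ℕ} (φ : Box.mk k ⟶ Box.mk m)
    (ψ : Box.mk m ⟶ Box.mk n) (x : Cubes X n) :
    X.map (φ ≫ ψ).op x = X.map φ.op (X.map ψ.op x) := by
  simp

theorem cubes_map_id (X : CubicalSet.{u}) {n : ℕ} (x : Cubes X n) :
    X.map (𝟙 (Box.mk n)).op x = x := by
  simp

/-- If `ψ` factored through a face, restricting along a section of `φ` would exhibit `x` as a
restriction of that face of `x`. -/
theorem Nondeg.isDegen_of_map_eq {X : CubicalSet.{u}} {k n : ℕ} {x : Cubes X n} (hx : Nondeg x)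
    {φ ψ : Box.mk k ⟶ Box.mk n} (hφ : Box.IsDegen φ) (h : X.map φ.op x = X.map ψ.op x) :
    Box.IsDegen ψ := by
  refine (Box.isDegen_or_hasConst ψ).resolve_right ?_
  rintro ⟨j, c, hc⟩
  obtain _ | n := n
  · exact j.elim0
  obtain ⟨s, hs⟩ := hφ.exists_section
  refine hx n (Nat.lt_succ_self n) (X.map (Box.face j c).op x) (s ≫ ψ ≫ Box.degen j) ?_
  rw [← cubes_map_comp, Category.assoc, ← Box.eq_comp_face hc, cubes_map_comp, ← h,
    ← cubes_map_comp, hs, cubes_map_id]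

namespace Box

/-- A composite of degeneracies and connections other than the identity either has a coordinate
`j` such that it remains such a composite on both faces in direction `j`, or it has two coordinates
`a`, `b` and an `ε` such that it remains such a composite on the faces `(a, ε)` and `(b, ε)`, and
its value at points outside these faces does not change when they are moved to `(a, ε)`. -/
theorem IsDegen.exists_faces {k n : ℕ} {φ : Box.mk (k + 1) ⟶ Box.mk n} (h : IsDegen φ)
    (hn : n ≠ k + 1) :
    (∃ j, ∀ ε, IsDegen (face j ε ≫ φ)) ∨
    ∃ (a b : Fin (k + 1)) (ε : Bool), IsDegen (face a ε ≫ φ) ∧ IsDegen (face b ε ≫ φ) ∧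
      ∀ x, x a ≠ ε → x b ≠ ε → φ.1 (Function.update x a ε) = φ.1 x := by
  cases h with
  | id => exact absurd rfl hn
  | @degen m _ i φ h =>
    refine Or.inl ⟨i, fun ε => ?_⟩
    rwa [← Category.assoc, face_degen, Category.id_comp]
  | @conn m _ i ε φ h =>
    refine Or.inr ⟨i.castSucc, i.succ, ε, ?_, ?_, fun x h₁ h₂ => congrArg φ.1 (funext fun j => ?_)⟩
    · rwa [← Category.assoc, face_conn i ε (.inl rfl), Category.id_comp]
    · rwa [← Category.assoc, face_conn i ε (.inr rfl), Category.id_comp]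
    · change connFun i ε _ j = connFun i ε x j
      simp only [connFun]
      split_ifs with h₃ h₄ h₅
      · rw [Function.update_of_ne]
        exact fun e => absurd h₃ (by rw [Fin.castSucc_inj.1 e]; exact lt_irrefl _)
      · subst h₄
        rw [Function.update_self, Function.update_of_ne (by simp [Fin.ext_iff])]
        cases ε <;> simp_all
      · subst h₄
        rw [Function.update_self, Function.update_of_ne (by simp [Fin.ext_iff])]
        cases ε <;> simp_all
      · rw [Function.update_of_ne]
        rw [Ne, Fin.ext_iff, Fin.val_succ, Fin.val_castSucc]
        have : ¬ j.1 < i.1 := h₃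
        omega

end Box

/-- Induction on the dimension: the two maps agree on each face on which one of them remains a
composite of degeneracies and connections. By `Box.IsDegen.exists_faces`, these faces determine the
maps, either directly or after moving a coordinate. -/
theorem Nondeg.eq_of_map_eq {X : CubicalSet.{u}} {n : ℕ} {x : Cubes X n} (hx : Nondeg x) :
    ∀ {k : ℕ} {φ ψ : Box.mk k ⟶ Box.mk n}, Box.IsDegen φ → Box.IsDegen ψ →
      X.map φ.op x = X.map ψ.op x → φ = ψ := by
  intro k
  induction k with
  | zero =>
    intro φ ψ hφ hψ _
    obtain h | ⟨rfl, -⟩ := hφ.lt_or_eq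
    · exact absurd h (Nat.not_lt_zero _)
    · rw [hφ.eq_id, hψ.eq_id]
  | succ k ih =>
    have key : ∀ {φ ψ : Box.mk (k + 1) ⟶ Box.mk n}, X.map φ.op x = X.map ψ.op x →
        ∀ (a : Fin (k + 1)) (ε : Bool), Box.IsDegen (Box.face a ε ≫ φ) →
        ∀ v, v a = ε → φ.1 v = ψ.1 v := by
      intro φ ψ h a ε ha v hv
      have e : X.map (Box.face a ε ≫ φ).op x = X.map (Box.face a ε ≫ ψ).op x := by
        rw [cubes_map_comp, cubes_map_comp, h]
      have e' := ih ha (hx.isDegen_of_map_eq ha e) e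
      have e'' := congrFun (congrArg Subtype.val e') (degenFun a v)
      change φ.1 (faceFun a ε (degenFun a v)) = ψ.1 (faceFun a ε (degenFun a v)) at e''
      rwa [← hv, faceFun_degenFun] at e''
    intro φ ψ hφ hψ h
    by_cases hn : n = k + 1
    · subst hn
      rw [hφ.eq_id, hψ.eq_id]
    refine Box.hom_ext fun v => ?_
    obtain ⟨j, hj⟩ | ⟨a, b, ε, ha, hb, hab⟩ := hφ.exists_faces hn
    · exact key h j (v j) (hj _) v rfl
    obtain ⟨j, hj⟩ | ⟨a', b', ε', ha', hb', hab'⟩ := hψ.exists_faces hn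
    · exact (key h.symm j (v j) (hj _) v rfl).symm
    by_cases h₁ : v a = ε
    · exact key h a ε ha v h₁
    by_cases h₂ : v b = ε
    · exact key h b ε hb v h₂
    by_cases h₃ : v a' = ε'
    · exact (key h.symm a' ε' ha' v h₃).symm
    by_cases h₄ : v b' = ε'
    · exact (key h.symm b' ε' hb' v h₄).symm
    have e₁ : φ.1 v = ψ.1 (Function.update v a ε) := by
      rw [← hab v h₁ h₂]
      exact key h a ε ha _ (Function.update_self ..)
    have e₂ : ψ.1 v = φ.1 (Function.update v a' ε') := by
      rw [← hab' v h₃ h₄]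
      exact key h.symm a' ε' ha' _ (Function.update_self ..)
    -- Now `v` lies off all four faces. If `ε = ε'`, both moves go in the same direction, so `e₁`,
    -- `e₂` and monotonicity give the two inequalities. Otherwise the moved coordinates differ, the
    -- moves commute, and both values equal the value at the doubly moved point.
    by_cases hε : ε = ε'
    · subst hε
      cases ε
      · have l₁ : ∀ c, Function.update v c false ≤ v := fun c =>
          update_le_iff.2 ⟨Bool.false_le _, fun _ _ => le_rfl⟩
        exact le_antisymm (e₁ ▸ ψ.2.monotone (l₁ a)) (e₂ ▸ φ.2.monotone (l₁ a'))
      · have l₁ : ∀ c, v ≤ Function.update v c true := fun c =>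
          le_update_iff.2 ⟨Bool.le_true _, fun _ _ => le_rfl⟩
        exact le_antisymm (e₂ ▸ φ.2.monotone (l₁ a')) (e₁ ▸ ψ.2.monotone (l₁ a))
    · have ne : ∀ {c c'}, v c ≠ ε → v c' ≠ ε' → c ≠ c' := by
        rintro c _ h₁ h₂ rfl
        clear * - h₁ h₂ hε
        cases v c <;> cases ε <;> cases ε' <;> simp_all
      let w := Function.update v a' ε'
      have hw : Function.update (Function.update v a ε) a' ε' = Function.update w a ε :=
        Function.update_comm (ne h₁ h₃) _ _ _
      have wa : w a ≠ ε := by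
        change Function.update v a' ε' a ≠ ε
        rwa [Function.update_of_ne (ne h₁ h₃)]
      have wb : w b ≠ ε := by
        change Function.update v a' ε' b ≠ ε
        rwa [Function.update_of_ne (ne h₂ h₃)]
      rw [e₁, ← hab' _ (by rwa [Function.update_of_ne (ne h₁ h₃).symm])
        (by rwa [Function.update_of_ne (ne h₁ h₄).symm]),
        key h.symm a' ε' ha' _ (Function.update_self ..), hw, hab w wa wb, ← e₂]

/-! ### Attaching cubes along open boxes -/

theorem mem_openBox_iff {n k : ℕ} (p : Fin (n + 1) × Bool) (φ : Box.mk k ⟶ Box.mk (n + 1)) :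
    ULift.up φ ∈ (openBox.{u} n p).obj (op (Box.mk k)) ↔ ∃ q ≠ p, ∀ x, φ.1 x q.1 = q.2 := by
  simp only [openBox, Subfunctor.iSup_obj, Set.mem_iUnion]
  constructor
  · rintro ⟨q, hq, ⟨ψ⟩, h⟩
    refine ⟨q, hq, fun x => ?_⟩
    have h : ψ ≫ Box.face q.1 q.2 = φ := congrArg ULift.down h
    rw [← h]
    exact faceFun_self _ _ _
  · rintro ⟨q, hq, h⟩
    exact ⟨q, hq, ULift.up (φ ≫ Box.degen q.1), congrArg ULift.up (Box.eq_comp_face h).symm⟩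

/-- A map `[1]^k → [1]^(n+1)` outside an open box is a composite of degeneracies and connections
possibly followed by the missing face. -/
theorem isDegen_or_of_not_mem_openBox {n k : ℕ} {p : Fin (n + 1) × Bool}
    {φ : Box.mk k ⟶ Box.mk (n + 1)} (h : ¬ ∃ q ≠ p, ∀ x, φ.1 x q.1 = q.2) :
    Box.IsDegen φ ∨ ∃ φ' : Box.mk k ⟶ Box.mk n, Box.IsDegen φ' ∧ φ = φ' ≫ Box.face p.1 p.2 := by
  refine (Box.isDegen_or_hasConst φ).imp_right ?_
  rintro ⟨j, c, hc⟩
  have hp : (j, c) = p := by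
    by_contra hp
    exact h ⟨(j, c), hp, hc⟩
  subst hp
  have e := Box.eq_comp_face hc
  refine ⟨φ ≫ Box.degen j, (Box.isDegen_or_hasConst _).resolve_right ?_, e⟩
  rintro ⟨j', c', hc'⟩
  refine h ⟨(j.succAbove j', c'), ?_, hc'⟩
  intro e
  exact Fin.succAbove_ne j j' (congrArg Prod.fst e)

/-- The pushout square attaching a nondegenerate cube along an open box. -/
theorem isPushout_attach {X : CubicalSet.{u}} (A : Subfunctor X) {n : ℕ} (p : Fin (n + 1) × Bool)
    {y : Cubes X (n + 1)} (hy : Nondeg y) (hf : Nondeg (X.map (Box.face p.1 p.2).op y))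
    (hfA : X.map (Box.face p.1 p.2).op y ∉ A.obj _)
    (hA : ∀ q ≠ p, X.map (Box.face q.1 q.2).op y ∈ A.obj _) :
    ∃ (t : (openBox.{u} n p).toFunctor ⟶ A.toFunctor)
      (b : cube.{u} (n + 1) ⟶ (A ⊔ Subfunctor.ofSection y).toFunctor),
      IsPushout t (openBox.{u} n p).ι
        (Subfunctor.homOfLe (le_sup_left : A ≤ A ⊔ Subfunctor.ofSection y)) b := by
  let β : cube.{u} (n + 1) ⟶ X := uliftYonedaEquiv.symm y
  have hβ : ∀ {k : ℕ} (φ : Box.mk k ⟶ Box.mk (n + 1)),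
      β.app (op (Box.mk k)) (ULift.up φ) = X.map φ.op y := fun φ => rfl
  -- The open box is the whole preimage of `A`: for a map outside it, restriction along a section
  -- recovers `y` or the missing face, and neither lies in `A`.
  have memA : ∀ {k : ℕ} (φ : Box.mk k ⟶ Box.mk (n + 1)),
      (∃ q ≠ p, ∀ x, φ.1 x q.1 = q.2) ↔ X.map φ.op y ∈ A.obj _ := by
    intro k φ
    constructor
    · rintro ⟨q, hq, h⟩
      rw [Box.eq_comp_face h, cubes_map_comp]
      exact A.map _ (hA q hq)
    · intro h
      by_contra hφ
      have hyA : y ∉ A.obj _ := fun h => hfA (A.map _ h)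
      obtain h' | ⟨φ', h', rfl⟩ := isDegen_or_of_not_mem_openBox hφ
      · obtain ⟨s, hs⟩ := h'.exists_section
        apply hyA
        rw [← cubes_map_id X y, ← hs, cubes_map_comp]
        exact A.map _ h
      · obtain ⟨s, hs⟩ := h'.exists_section
        apply hfA
        rw [← cubes_map_id X (X.map _ y), ← hs, cubes_map_comp, ← cubes_map_comp X φ']
        exact A.map _ h
  have h₁ : Subfunctor.range ((openBox.{u} n p).ι ≫ β) ≤ A := by
    rintro ⟨⟨k⟩⟩ _ ⟨⟨⟨φ⟩, hφ⟩, rfl⟩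
    exact (memA φ).1 ((mem_openBox_iff p φ).1 hφ)
  have h₂ : Subfunctor.range β ≤ A ⊔ Subfunctor.ofSection y := by
    rintro ⟨⟨k⟩⟩ _ ⟨⟨φ⟩, rfl⟩
    exact Or.inr ⟨φ.op, rfl⟩
  refine ⟨Subfunctor.lift _ h₁, Subfunctor.lift _ h₂, ⟨⟨rfl⟩, ⟨?_⟩⟩⟩
  refine Limits.evaluationJointlyReflectsColimits _ fun ⟨⟨k⟩⟩ => ?_
  refine (Limits.isColimitMapCoconePushoutCoconeEquiv _ _).symm (IsPushout.isColimit ?_)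
  -- Outside the box only degeneracies of `y` and of the missing face occur. The two kinds cannot
  -- coincide because `y` is nondegenerate, and within each kind uniqueness applies.
  have inj : ∀ (φ ψ : Box.mk k ⟶ Box.mk (n + 1)), (¬ ∃ q ≠ p, ∀ x, φ.1 x q.1 = q.2) →
      (¬ ∃ q ≠ p, ∀ x, ψ.1 x q.1 = q.2) → X.map φ.op y = X.map ψ.op y → φ = ψ := by
    intro φ ψ hφ hψ h
    obtain h₁ | ⟨φ', h₁, rfl⟩ := isDegen_or_of_not_mem_openBox hφ
    · exact hy.eq_of_map_eq h₁ (hy.isDegen_of_map_eq h₁ h) h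
    · obtain h₂ | ⟨ψ', h₂, rfl⟩ := isDegen_or_of_not_mem_openBox hψ
      · exact hy.eq_of_map_eq (hy.isDegen_of_map_eq h₂ h.symm) h₂ h
      · rw [cubes_map_comp, cubes_map_comp] at h
        rw [hf.eq_of_map_eq h₁ h₂ h]
  have hmono : Mono (((CategoryTheory.evaluation _ _).obj (op (Box.mk k))).map
      (Subfunctor.homOfLe (le_sup_left : A ≤ A ⊔ Subfunctor.ofSection y))) := by
    rw [mono_iff_injective]
    rintro ⟨a, ha⟩ ⟨b, hb⟩ h
    have h : a = b := congrArg Subtype.val h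
    exact Subtype.ext h
  refine Limits.Types.isPushout_of_isPullback_of_mono' ?_ ?_ ?_
  · rw [Limits.Types.isPullback_iff]
    refine ⟨rfl, ?_, ?_⟩
    · rintro ⟨⟨φ⟩, hφ⟩ ⟨⟨ψ⟩, hψ⟩ ⟨-, h⟩
      exact Subtype.ext h
    · rintro ⟨a, ha⟩ ⟨φ⟩ h
      have h : a = X.map φ.op y := congrArg Subtype.val h
      refine ⟨⟨⟨φ⟩, (mem_openBox_iff p φ).2 ((memA φ).2 (h ▸ ha))⟩, Subtype.ext h.symm, rfl⟩
  · refine Set.eq_univ_of_forall ?_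
    rintro ⟨a, ha | ⟨φ, rfl⟩⟩
    · exact Or.inl ⟨⟨a, ha⟩, rfl⟩
    · exact Or.inr ⟨⟨φ.unop⟩, rfl⟩
  · rintro ⟨φ⟩ ⟨ψ⟩ hφ hψ h
    have h : X.map φ.op y = X.map ψ.op y := congrArg Subtype.val h
    refine congrArg ULift.up (inj φ ψ ?_ ?_ h)
    · exact fun h => hφ ⟨⟨⟨φ⟩, (mem_openBox_iff p φ).2 h⟩, rfl⟩
    · exact fun h => hψ ⟨⟨⟨ψ⟩, (mem_openBox_iff p ψ).2 h⟩, rfl⟩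

theorem openBoxInclusions_ι (n : ℕ) (p : Fin (n + 1) × Bool) :
    openBoxInclusions (openBox.{u} n p).ι := by
  simp only [openBoxInclusions, MorphismProperty.iSup_iff]
  exact ⟨n, ⟨p⟩⟩

theorem homOfLe_attach {W : MorphismProperty CubicalSet.{u}} (hW : IsSaturated W)
    (hW' : openBoxInclusions ≤ W) {X : CubicalSet.{u}} (A : Subfunctor X) {n : ℕ}
    (p : Fin (n + 1) × Bool)
    {y : Cubes X (n + 1)} (hy : Nondeg y) (hf : Nondeg (X.map (Box.face p.1 p.2).op y))
    (hfA : X.map (Box.face p.1 p.2).op y ∉ A.obj _)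
    (hA : ∀ q ≠ p, X.map (Box.face q.1 q.2).op y ∈ A.obj _) :
    W (Subfunctor.homOfLe (le_sup_left : A ≤ A ⊔ Subfunctor.ofSection y)) := by
  obtain ⟨t, b, h⟩ := isPushout_attach A p hy hf hfA hA
  have := hW.pushouts
  exact W.of_isPushout h (hW' _ (openBoxInclusions_ι n p))

/-! ### Transfinite compositions of inclusions -/

/-- Colimits of presheaves are computed objectwise, and a chain of sets with jointly surjective
injective legs is a union. -/
theorem nonempty_isColimit_of_injective {J : Type*} [LinearOrder J] {F : J ⥤ CubicalSet.{u}}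
    (c : Limits.Cocone F)
    (inj : ∀ (j : J) (n : ℕ), Function.Injective ((c.ι.app j).app (op (Box.mk n))))
    (surj : ∀ (n : ℕ) (x : Cubes c.pt n), ∃ (j : J) (y : Cubes (F.obj j) n),
      (c.ι.app j).app _ y = x) : Nonempty (Limits.IsColimit c) := by
  refine ⟨Limits.evaluationJointlyReflectsColimits _ fun ⟨⟨n⟩⟩ =>
    Limits.Types.FilteredColimit.isColimitOf' _ _ (fun x => ?_) (fun j x y h => ?_)⟩
  · obtain ⟨j, y, h⟩ := surj n x
    exact ⟨j, y, h.symm⟩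
  · refine ⟨j, 𝟙 j, ?_⟩
    rw [inj j n h]

/-- A subobject is sent to itself as a cubical set. -/
def subfunctorToCubicalSet (X : CubicalSet.{u}) : Subfunctor X ⥤ CubicalSet.{u} where
  obj A := A.toFunctor
  map f := Subfunctor.homOfLe (leOfHom f)

/-- If every subobject with the property `P` other than `⊤` may be enlarged to one with the
property `P` by a map in `W`, then its inclusion is in `W`. -/
theorem subfunctor_ι_mem {W : MorphismProperty CubicalSet.{u}} (hW : IsSaturated W)
    {X : CubicalSet.{u}} {P : Subfunctor X → Prop}
    (hP : ∀ S : Set (Subfunctor X), S.Nonempty → IsChain (· ≤ ·) S → (∀ A ∈ S, P A) → P (sSup S))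
    (step : ∀ A, P A → A ≠ ⊤ → ∃ (A' : Subfunctor X) (h : A < A'), P A' ∧
      W (Subfunctor.homOfLe h.le)) {A₀ : Subfunctor X} (h₀ : P A₀) : W A₀.ι := by
  classical
  have := hW.transfinite
  choose! next lt_next next_P next_W using step
  -- The default value `⊤` makes `φ` strictly increasing at every subobject other than `⊤`,
  -- including those without `P`, as required for iterating it up to `⊤`.
  let φ : Subfunctor X → Subfunctor X := fun A => if P A ∧ A ≠ ⊤ then next A else ⊤
  have hφ : ∀ A ≠ ⊤, A < φ A := by
    intro A hA
    by_cases h : P A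
    · simp only [φ, h, hA, true_and, ne_eq, not_false_eq_true, if_true]
      exact lt_next A h hA
    · simp only [φ, h, false_and, if_false]
      exact hA.lt_top
  have φ_top : φ ⊤ = ⊤ := by simp [φ]
  have le_φ : ∀ A, A ≤ φ A := fun A => by
    by_cases h : A = ⊤
    · rw [h, φ_top]
    · exact (hφ A h).le
  have φ_P : ∀ A, P A → P (φ A) := fun A hA => by
    by_cases h : A = ⊤
    · subst h
      rwa [φ_top]
    · simp only [φ, h, hA, true_and, ne_eq, not_false_eq_true, if_true]
      exact next_P A hA h
  have φ_W : ∀ A, P A → W (Subfunctor.homOfLe (le_φ A)) := by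
    intro A hA
    have key : ∀ B (h : A ≤ B), φ A = B → W (Subfunctor.homOfLe h) := by
      rintro B h rfl
      by_cases h' : A = ⊤
      · have : ∀ B (h : A ≤ B), A = B → W (Subfunctor.homOfLe h) := by
          rintro _ _ rfl
          exact W.id_mem _
        exact this _ _ (by rw [h', φ_top])
      · have e : φ A = next A := by
          simp only [φ, h', hA, true_and, ne_eq, not_false_eq_true, if_true]
        have : ∀ B (h : A ≤ B), B = next A → W (Subfunctor.homOfLe h) := by
          rintro _ _ rfl
          exact next_W A hA h'
        exact this _ _ e
    exact key _ _ rfl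
  -- The iteration is indexed by more stages than there are subobjects, so it cannot be injective
  -- and must reach `⊤`.
  let κ := Order.succ (Cardinal.mk (Subfunctor X))
  let J := κ.ord.ToType
  have : Nonempty J := by simp [J, κ]
  let _ := WellFoundedLT.toOrderBot J
  let _ := SuccOrder.ofLinearWellFoundedLT J
  let T : J → Subfunctor X := fun j => transfiniteIterate φ j A₀
  have hT : Monotone T := monotone_transfiniteIterate φ A₀ le_φ
  obtain ⟨j₁, hj₁⟩ : ∃ j, T j = ⊤ := by
    refine top_mem_range_transfiniteIterate φ A₀ hφ φ_top fun h => ?_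
    have := Cardinal.mk_le_of_injective h
    rw [← not_lt] at this
    exact this ((Order.lt_succ _).trans_eq (Cardinal.mk_ord_toType κ).symm)
  have T_bot : T ⊥ = A₀ := transfiniteIterate_bot _ _
  have T_limit : ∀ j, Order.IsSuccLimit j → T j = ⨆ x : Set.Iio j, T x.1 :=
    fun j hj => transfiniteIterate_limit φ A₀ j hj
  have T_P : ∀ j, P (T j) := by
    intro j
    induction j using SuccOrder.limitRecOn with
    | isMin j hj =>
      obtain rfl := hj.eq_bot
      rwa [T_bot]
    | succ j hj ih =>
      change P (transfiniteIterate φ _ A₀)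
      rw [transfiniteIterate_succ _ _ _ hj]
      exact φ_P _ ih
    | isSuccLimit j hj ih =>
      rw [T_limit j hj]
      refine hP _ ⟨_, ⟨⟨⊥, hj.bot_lt⟩, rfl⟩⟩ ?_ ?_
      · rintro _ ⟨x, rfl⟩ _ ⟨y, rfl⟩ -
        exact (le_total x.1 y.1).imp (fun h => hT h) (fun h => hT h)
      · rintro _ ⟨x, rfl⟩
        exact ih x.1 x.2
  let F : J ⥤ CubicalSet.{u} := hT.functor ⋙ subfunctorToCubicalSet X
  have F_cont : F.IsWellOrderContinuous := by
    refine ⟨fun m hm => nonempty_isColimit_of_injective _ ?_ ?_⟩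
    · rintro j n ⟨a, ha⟩ ⟨b, hb⟩ h
      have h : a = b := congrArg Subtype.val h
      exact Subtype.ext h
    · rintro n ⟨x, hx⟩
      change x ∈ (T m).obj _ at hx
      rw [T_limit m hm, Subfunctor.iSup_obj, Set.mem_iUnion] at hx
      obtain ⟨j, hj⟩ := hx
      exact ⟨j, ⟨x, hj⟩, rfl⟩
  let c : Limits.Cocone F :=
    { pt := X
      ι := { app := fun j => (T j).ι } }
  obtain ⟨hc⟩ : Nonempty (Limits.IsColimit c) := by
    refine nonempty_isColimit_of_injective _ (fun j n a b h => Subtype.ext h) fun n x => ?_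
    refine ⟨j₁, ⟨x, ?_⟩, rfl⟩
    change x ∈ (T j₁).obj _
    rw [hj₁]
    trivial
  have e : ∀ {A B : Subfunctor X} (h : A = B),
      (eqToIso (congrArg Subfunctor.toFunctor h)).inv ≫ A.ι = B.ι := by
    rintro A _ rfl
    simp
  refine W.transfiniteCompositionsOfShape_le J _ ⟨
    { F := F
      isoBot := eqToIso (congrArg Subfunctor.toFunctor T_bot)
      isWellOrderContinuous := F_cont
      incl := c.ι
      isColimit := hc
      fac := e T_bot
      map_mem := fun j hj => ?_ }⟩
  have key : ∀ B (h : T j ≤ B), B = φ (T j) → W (Subfunctor.homOfLe h) := by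
    rintro _ _ rfl
    exact φ_W _ (T_P j)
  exact key _ (hT (Order.le_succ j)) (transfiniteIterate_succ _ _ _ hj)

/-! ### The nerve as a sequential colimit -/

theorem collapse_surjective (m : ℕ) : Function.Surjective (collapse m) := by
  intro a
  refine ⟨(a.1 : ℤ) - (m / 2 : ℕ), ?_⟩
  rw [Fin.ext_iff, ← Int.ofNat_inj, collapse_val]
  simp only [clamp]
  omega

theorem nerveIncl_injective {V : Type u} (m : ℕ) (G : SimpleGraph V) (n : ℕ) :
    Function.Injective ((nerveIncl m G).app (op (Box.mk n))) := by
  rintro ⟨f, hf⟩ ⟨g, hg⟩ h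
  refine Subtype.ext (funext fun v => ?_)
  choose w hw using fun i => collapse_surjective m (v i)
  have : f (fun i => collapse m (w i)) = g (fun i => collapse m (w i)) :=
    congrFun (congrArg Subtype.val h) w
  rwa [funext hw] at this

/-- A map bounded by `M` is recovered from its restriction to `[-M, M + 1]`, which is the copy of
`I_(2M+1)` in `I_∞`. The odd length keeps the index positive when `M = 0`. -/
theorem exists_nerveIncl_eq {V : Type u} (G : SimpleGraph V) {n : ℕ} (x : Cubes (nerve G) n) :
    ∃ (k : ℕ) (f : Cubes (finiteNerve (k + 1) G) n), (nerveIncl (k + 1) G).app _ f = x := by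
  obtain ⟨f, hf, hs⟩ := x
  obtain ⟨M, hM⟩ := exists_boundedBy hs
  let s : Fin (2 * M + 2) → ℤ := fun a => a.1 - M
  have hgs : IsGraphMap (SimpleGraph.hasse _) (SimpleGraph.hasse _) s := by
    refine isGraphMap_of_covBy fun a b hab => Or.inl ?_
    rw [Fin.covBy_iff, Nat.covBy_iff_add_one_eq] at hab
    rw [Order.covBy_iff_add_one_eq]
    simp only [s]
    omega
  refine ⟨2 * M, ⟨fun v => f (fun i => s (v i)), hf.comp (isGraphMap_pi hgs n)⟩, ?_⟩
  refine Subtype.ext (funext fun v => ?_)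
  change f (fun i => s (collapse (2 * M + 1) (v i))) = f v
  rw [← hM, ← hM v]
  refine congrArg f (funext fun i => ?_)
  have := collapse_val (2 * M + 1) (v i)
  simp only [s, clamp] at this ⊢
  omega

theorem nonempty_isColimit_nerveCocone {V : Type u} (G : SimpleGraph V) :
    Nonempty (Limits.IsColimit (nerveCocone G)) :=
  nonempty_isColimit_of_injective _ (fun k n => nerveIncl_injective (k + 1) G n)
    (fun _ x => exists_nerveIncl_eq G x)

/-- The inclusion is the transfinite composition of the sequence of finite nerves over `ℕ`. -/
theorem nerveIncl_one_mem {W : MorphismProperty CubicalSet.{u}} (hW : IsSaturated W) {V : Type u}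
    (G : SimpleGraph V) (h : ∀ m, 0 < m → W (lStar m G) ∧ W (rStar m G)) :
    W (nerveIncl 1 G) := by
  have := hW.transfinite
  have := MorphismProperty.IsStableUnderTransfiniteComposition.shrink₀.{u} W
  obtain ⟨hc⟩ := nonempty_isColimit_nerveCocone G
  refine W.transfiniteCompositionsOfShape_le ℕ _ ⟨
    { F := nerveSequence G
      isoBot := Iso.refl _
      isWellOrderContinuous := inferInstance
      incl := (nerveCocone G).ι
      isColimit := hc
      fac := Category.id_comp _
      map_mem := fun k _ => ?_ }⟩
  change W ((nerveSequence G).map (homOfLE (Nat.le_succ k)))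
  have e : (nerveSequence G).map (homOfLE (Nat.le_succ k)) =
      if Even k then lStar (k + 1) G else rStar (k + 1) G :=
    Functor.ofSequence_map_homOfLE_succ _ k
  rw [e]
  split_ifs
  · exact (h _ (Nat.succ_pos k)).1
  · exact (h _ (Nat.succ_pos k)).2

/-! ### The nerve is a Kan complex -/

theorem BoundedBy.mono {V : Type*} {n : ℕ} {f : (Fin n → ℤ) → V} {M K : ℕ} (h : BoundedBy f M)
    (hMK : M ≤ K) : BoundedBy f K := by
  intro v
  rw [← h, ← h v]
  refine congrArg f (funext fun i => ?_)
  simp only [clamp]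
  omega

theorem IsGraphMap.adj_or_eq_of_near {V : Type*} {G : SimpleGraph V} {n : ℕ} {f : (Fin n → ℤ) → V}
    (hf : IsGraphMap (grid ℤ n) G f) {v w : Fin n → ℤ} (i : Fin n) (h : ∀ j, j ≠ i → v j = w j)
    (h₁ : v i ≤ w i + 1) (h₂ : w i ≤ v i + 1) : G.Adj (f v) (f w) ∨ f v = f w := by
  by_cases e : v i = w i
  · refine Or.inr (congrArg f (funext fun j => ?_))
    by_cases hj : j = i
    · rw [hj, e]
    · exact h j hj
  · refine hf ⟨i, ?_, h⟩
    rw [SimpleGraph.hasse_adj, Order.covBy_iff_add_one_eq, Order.covBy_iff_add_one_eq]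
    omega

theorem isGraphMap_of_succ {V : Type*} {G : SimpleGraph V} {n : ℕ} {f : (Fin n → ℤ) → V}
    (hf : ∀ (v w : Fin n → ℤ) (i : Fin n), (∀ j, j ≠ i → v j = w j) → w i = v i + 1 →
      G.Adj (f v) (f w) ∨ f v = f w) : IsGraphMap (grid ℤ n) G f := by
  rintro v w ⟨i, h | h, h'⟩
  · exact hf v w i h' (Order.covBy_iff_add_one_eq.1 h).symm
  · exact (hf w v i (fun j hj => (h' j hj).symm) (Order.covBy_iff_add_one_eq.1 h).symm).imp
      SimpleGraph.Adj.symm Eq.symm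

/-! ### Retraction of the integer grid onto an open box -/

section Filler

variable {n : ℕ} (p : Fin (n + 1) × Bool) (M : ℕ)

/-- The end point `±M` of the interval `[-M, M]`. -/
def endpt (M : ℕ) (ε : Bool) : ℤ := if ε then M else -M

/-- The maximal distance of the coordinates of `w` other than the `p.1`-st from `[-M, M]`. -/
def excess (w : Fin (n + 1) → ℤ) : ℕ :=
  Finset.univ.sup fun j => if j = p.1 then 0 else (|w j| - M).toNat

/-- The retraction to an open box: it truncates the coordinates of `w` to `[-M, M]`, and moves
the coordinate `p.1` away from the missing face unless other coordinates are far outside. -/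
def openBoxRetract (w : Fin (n + 1) → ℤ) (j : Fin (n + 1)) : ℤ :=
  if j = p.1 then
    (if p.2 then min (clamp (-(M : ℤ)) M (w j)) (-M + excess p M w)
      else max (clamp (-(M : ℤ)) M (w j)) (M - excess p M w))
  else clamp (-(M : ℤ)) M (w j)

variable {p M}

theorem le_excess (w : Fin (n + 1) → ℤ) {j : Fin (n + 1)} (hj : j ≠ p.1) :
    |w j| - M ≤ excess p M w := by
  have := Finset.le_sup (f := fun j => if j = p.1 then 0 else (|w j| - M).toNat)
    (Finset.mem_univ j)
  simp only [if_neg hj] at this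
  exact (Int.self_le_toNat _).trans (by exact_mod_cast this)

theorem excess_le_iff (w : Fin (n + 1) → ℤ) (K : ℕ) :
    excess p M w ≤ K ↔ ∀ j, j ≠ p.1 → |w j| - M ≤ K := by
  refine ⟨fun h j hj => (le_excess w hj).trans (by exact_mod_cast h), fun h => ?_⟩
  refine Finset.sup_le fun j _ => ?_
  split_ifs with hj
  · exact Nat.zero_le _
  · exact Int.toNat_le.2 (h j hj)

theorem excess_pos (w : Fin (n + 1) → ℤ) (h : excess p M w ≠ 0) :
    ∃ j, j ≠ p.1 ∧ (M : ℤ) < |w j| := by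
  by_contra! h'
  refine h (Nat.le_zero.1 ((excess_le_iff w 0).2 fun j hj => ?_))
  have := h' j hj
  push_cast
  omega

theorem excess_congr {v w : Fin (n + 1) → ℤ} (h : ∀ j, j ≠ p.1 → v j = w j) :
    excess p M v = excess p M w :=
  Finset.sup_congr rfl fun j _ => by
    by_cases hj : j = p.1
    · simp [hj]
    · simp [hj, h j hj]

theorem openBoxRetract_mem (w : Fin (n + 1) → ℤ) (j : Fin (n + 1)) :
    -(M : ℤ) ≤ openBoxRetract p M w j ∧ openBoxRetract p M w j ≤ M := by
  simp only [openBoxRetract, clamp]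
  split_ifs <;> omega

theorem clamp_eq_endpt {t : ℤ} (h : (M : ℤ) ≤ |t|) :
    clamp (-(M : ℤ)) M t = endpt M (decide (0 ≤ t)) := by
  by_cases h₀ : 0 ≤ t
  · rw [abs_of_nonneg h₀] at h
    simp only [h₀, decide_true, endpt, if_true, clamp]
    omega
  · rw [abs_of_neg (not_le.1 h₀)] at h
    simp only [h₀, decide_false, endpt, Bool.false_eq_true, if_false, clamp]
    omega

/-- Adjacent points are retracted to near points in a common face. -/
theorem exists_common_face (hM : 0 < M) {v w : Fin (n + 1) → ℤ} {a : Fin (n + 1)}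
    (h : ∀ j, j ≠ a → v j = w j) (ha : w a = v a + 1) :
    ∃ q ≠ p, openBoxRetract p M v q.1 = endpt M q.2 ∧ openBoxRetract p M w q.1 = endpt M q.2 ∧
      ∃ b, (∀ j, j ≠ b → openBoxRetract p M v j = openBoxRetract p M w j) ∧
        openBoxRetract p M v b ≤ openBoxRetract p M w b + 1 ∧
        openBoxRetract p M w b ≤ openBoxRetract p M v b + 1 := by
  have zero : ∀ w, excess p M w = 0 → openBoxRetract p M w p.1 = endpt M (!p.2) := by
    intro w hw
    simp only [openBoxRetract, hw, if_true, clamp]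
    cases p.2 <;> simp [endpt]
  have out : ∀ w j, j ≠ p.1 → (M : ℤ) ≤ |w j| →
      openBoxRetract p M w j = endpt M (decide (0 ≤ w j)) := by
    intro w j hj hM
    rw [openBoxRetract, if_neg hj, clamp_eq_endpt hM]
  have ne_p : ∀ {j : Fin (n + 1)} {η : Bool}, j ≠ p.1 → (j, η) ≠ p :=
    fun hj e => hj (congrArg Prod.fst e)
  have ne_p' : (p.1, !p.2) ≠ p := fun e => by
    have := congrArg Prod.snd e
    simp at this
  -- If the step takes place outside the cube in a side direction, truncation hides it. Only the
  -- excess can change, by at most one, so the images differ only in coordinate `p.1` and share the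
  -- side face in direction `a`.
  by_cases hout : a ≠ p.1 ∧ (M : ℤ) ≤ |v a| ∧ (M : ℤ) ≤ |w a| ∧ (0 ≤ v a ↔ 0 ≤ w a)
  · obtain ⟨hap, hv, hw, hvw⟩ := hout
    refine ⟨(a, decide (0 ≤ v a)), ne_p hap, out v a hap hv, ?_, p.1, fun j hj => ?_, ?_⟩
    · simp only [hvw]
      exact out w a hap hw
    · simp only [openBoxRetract, if_neg hj]
      by_cases hja : j = a
      · subst hja
        rw [clamp_eq_endpt hv, clamp_eq_endpt hw]
        simp only [hvw]
      · rw [h j hja]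
    · have e₁ : excess p M v ≤ excess p M w + 1 := (excess_le_iff v _).2 fun j hj => by
        have := le_excess (M := M) w hj
        by_cases hja : j = a
        · subst hja
          have := abs_sub_abs_le_abs_sub (v j) (w j)
          rw [show v j - w j = -1 by omega] at this
          push_cast
          simp at this
          omega
        · rw [h j hja]
          push_cast
          omega
      have e₂ : excess p M w ≤ excess p M v + 1 := (excess_le_iff w _).2 fun j hj => by
        have := le_excess (M := M) v hj
        by_cases hja : j = a
        · subst hja
          have := abs_sub_abs_le_abs_sub (w j) (v j)
          rw [show w j - v j = 1 by omega] at this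
          push_cast
          simp at this
          omega
        · rw [← h j hja]
          push_cast
          omega
      have e₃ := h p.1 (Ne.symm hap)
      simp only [openBoxRetract, if_true, clamp]
      split_ifs <;> omega
  -- In all other cases the step is in direction `p.1` or stays within `[-M, M]`, so it does not
  -- affect the excess. Here `0 < M` rules out that a step across zero leaves the interval.
  · have e : excess p M v = excess p M w := by
      by_cases hap : a = p.1
      · exact excess_congr (hap ▸ h)
      · have hle : |v a| ≤ M ∧ |w a| ≤ M := by
          replace hout : ¬ ((M : ℤ) ≤ |v a| ∧ (M : ℤ) ≤ |w a| ∧ (0 ≤ v a ↔ 0 ≤ w a)) :=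
            fun h => hout ⟨hap, h⟩
          rcases abs_cases (v a) with ⟨h₁, h₂⟩ | ⟨h₁, h₂⟩ <;>
            rcases abs_cases (w a) with ⟨h₃, h₄⟩ | ⟨h₃, h₄⟩ <;> omega
        refine Finset.sup_congr rfl fun j _ => ?_
        by_cases hja : j = a
        · subst hja
          rw [Int.toNat_of_nonpos (by omega), Int.toNat_of_nonpos (by omega)]
        · rw [h j hja]
    have near : ∃ b, (∀ j, j ≠ b → openBoxRetract p M v j = openBoxRetract p M w j) ∧
        openBoxRetract p M v b ≤ openBoxRetract p M w b + 1 ∧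
        openBoxRetract p M w b ≤ openBoxRetract p M v b + 1 := by
      refine ⟨a, fun j hj => ?_, ?_⟩
      · simp only [openBoxRetract, e, h j hj]
      · simp only [openBoxRetract, e, ha, clamp]
        split_ifs <;> omega
    -- With zero excess both images lie on the face opposite to the missing one. Otherwise some
    -- coordinate outside `[-M, M]`, common to both points, gives a side face.
    by_cases h₀ : excess p M v = 0
    · exact ⟨(p.1, !p.2), ne_p', zero v h₀, zero w (e ▸ h₀), near⟩
    · by_cases hap : a = p.1
      · obtain ⟨j, hj, hM⟩ := excess_pos v h₀
        have hjv := h j (hap ▸ hj)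
        refine ⟨(j, decide (0 ≤ v j)), ne_p hj, out v j hj hM.le, ?_, near⟩
        simp only [hjv]
        exact out w j hj (hjv ▸ hM.le)
      · obtain ⟨j, hj, hM⟩ := excess_pos v h₀
        by_cases hja : j = a
        · exfalso
          subst hja
          replace hout : ¬ ((M : ℤ) ≤ |v j| ∧ (M : ℤ) ≤ |w j| ∧ (0 ≤ v j ↔ 0 ≤ w j)) :=
            fun h => hout ⟨hap, h⟩
          rcases abs_cases (v j) with ⟨h₁, h₂⟩ | ⟨h₁, h₂⟩ <;>
            rcases abs_cases (w j) with ⟨h₃, h₄⟩ | ⟨h₃, h₄⟩ <;> omega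
        · have hjv := h j hja
          refine ⟨(j, decide (0 ≤ v j)), ne_p hj, out v j hj hM.le, ?_, near⟩
          simp only [hjv]
          exact out w j hj (hjv ▸ hM.le)

theorem exists_face (hM : 0 < M) (w : Fin (n + 1) → ℤ) :
    ∃ q ≠ p, openBoxRetract p M w q.1 = endpt M q.2 := by
  obtain ⟨q, hq, h, -⟩ := exists_common_face (p := p) hM (v := w)
    (w := Function.update w p.1 (w p.1 + 1)) (a := p.1)
    (fun j hj => (Function.update_of_ne hj _ _).symm) (Function.update_self ..)
  exact ⟨q, hq, h⟩

/-- An excess of `2 * M` already lifts the restriction on coordinate `p.1`, since `[-M, M]` has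
length `2 * M`. Coordinates beyond `±3M` therefore have no further effect. -/
theorem openBoxRetract_clamp (w : Fin (n + 1) → ℤ) :
    openBoxRetract p M (fun i => clamp (-((3 * M : ℕ) : ℤ)) (3 * M : ℕ) (w i)) =
      openBoxRetract p M w := by
  have e : ∀ K : ℕ, K ≤ 2 * M → (excess p M (fun i => clamp (-((3 * M : ℕ) : ℤ)) (3 * M : ℕ) (w i))
      ≤ K ↔ excess p M w ≤ K) ∨ K = 2 * M := by
    intro K hK
    rcases hK.lt_or_eq with hK | hK
    · left
      rw [excess_le_iff, excess_le_iff]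
      refine forall_congr' fun j => imp_congr_right fun _ => ?_
      simp only [clamp]
      rcases abs_cases (w j) with ⟨h₁, h₂⟩ | ⟨h₁, h₂⟩ <;>
        rcases abs_cases (max (-((3 * M : ℕ) : ℤ)) (min ((3 * M : ℕ) : ℤ) (w j)))
          with ⟨h₃, h₄⟩ | ⟨h₃, h₄⟩ <;> omega
    · exact Or.inr hK
  generalize hA : excess p M (fun i => clamp (-((3 * M : ℕ) : ℤ)) (3 * M : ℕ) (w i)) = A at e
  generalize hB : excess p M w = B at e
  have hAB : A = B ∨ (2 * M ≤ A ∧ 2 * M ≤ B) := by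
    have h₁ := e A
    have h₂ := e B
    omega
  funext j
  simp only [openBoxRetract, hA, hB]
  simp only [clamp]
  split_ifs <;> omega

/-- On a side face of the cube of radius `3 * M` the excess is at least `2 * M`, so the extra bound
is void. On the face opposite to `p`, truncation already gives the extreme value that the bound
always permits. -/
theorem openBoxRetract_eq_clamp {w : Fin (n + 1) → ℤ} {q : Fin (n + 1) × Bool} (hq : q ≠ p)
    (h : w q.1 = endpt (3 * M) q.2) :
    openBoxRetract p M w = fun j => clamp (-(M : ℤ)) M (w j) := by
  funext j
  by_cases hj : j = p.1
  · subst hj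
    by_cases hqp : q.1 = p.1
    · have hq2 : q.2 = !p.2 := by
        have : q.2 ≠ p.2 := fun e => hq (Prod.ext hqp e)
        revert this
        cases q.2 <;> cases p.2 <;> simp
      rw [hqp, hq2] at h
      simp only [openBoxRetract, if_true, h, clamp]
      cases p.2 <;> simp only [endpt, Bool.not_false, Bool.not_true, if_true, Bool.false_eq_true,
        if_false] <;> omega
    · have := le_excess (M := M) w hqp
      have h' : |w q.1| = 3 * M := by
        rw [h]
        cases q.2 <;> simp [endpt, abs_mul]
      simp only [openBoxRetract, if_true, clamp]
      split_ifs <;> omega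
  · simp only [openBoxRetract, if_neg hj]

end Filler

/-- The filler evaluates the given faces at the retracted point. Compatibility on intersections of
faces is stated after pulling back to the whole cube, which avoids reindexing faces of codimension
two. -/
theorem exists_filler {V : Type u} (G : SimpleGraph V) {n : ℕ} (p : Fin (n + 1) × Bool)
    (c : ∀ q, q ≠ p → Cubes (nerve G) n)
    (hc : ∀ q q' hq hq', q.1 ≠ q'.1 →
      (nerve G).map (Box.degen q'.1 ≫ Box.face q'.1 q'.2 ≫ Box.degen q.1).op (c q hq) =
        (nerve G).map (Box.degen q.1 ≫ Box.face q.1 q.2 ≫ Box.degen q'.1).op (c q' hq')) :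
    ∃ F : Cubes (nerve G) (n + 1), ∀ q hq, (nerve G).map (Box.face q.1 q.2).op F = c q hq := by
  -- Positivity keeps opposite faces disjoint and is needed by `exists_common_face`.
  obtain ⟨M, hM₀, hM⟩ : ∃ M : ℕ, 0 < M ∧ ∀ q hq, BoundedBy (c q hq).1 M := by
    refine ⟨Finset.univ.sup (fun q => if hq : q ≠ p then (c q hq).bound else 0) + 1,
      Nat.succ_pos _, fun q hq => (c q hq).boundedBy.mono ?_⟩
    have := Finset.le_sup (f := fun q => if hq : q ≠ p then (c q hq).bound else 0)
      (Finset.mem_univ q)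
    simp only [dif_pos hq] at this
    exact this.trans (Nat.le_succ _)
  have compat : ∀ (w : Fin (n + 1) → ℤ), (∀ j, -(M : ℤ) ≤ w j ∧ w j ≤ M) → ∀ q q' hq hq',
      w q.1 = endpt M q.2 → w q'.1 = endpt M q'.2 →
      (c q hq).1 (degenFun q.1 w) = (c q' hq').1 (degenFun q'.1 w) := by
    intro w hw q q' hq hq' h h'
    by_cases e : q.1 = q'.1
    · have e₂ : q.2 = q'.2 := by
        rw [← e, h] at h'
        revert h'
        cases q.2 <;> cases q'.2 <;> simp [endpt] <;> omega
      obtain rfl : q = q' := Prod.ext e e₂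
      rfl
    · have key : ∀ q q' : Fin (n + 1) × Bool, w q'.1 = endpt M q'.2 →
          boxAct (-(M : ℤ)) M (Box.degen q'.1 ≫ Box.face q'.1 q'.2 ≫ Box.degen q.1).1 w =
            degenFun q.1 w := by
        intro q q' h'
        have hw' : (fun j => clamp (-(M : ℤ)) M (w j)) = w :=
          funext fun j => clamp_eq_self (hw j).1 (hw j).2
        have e₁ : boxAct (-(M : ℤ)) M (degenFun (α := Bool) q'.1) w = degenFun q'.1 w := by
          rw [boxAct_degen (neg_cast_le M), hw']
        have e₂ : boxAct (-(M : ℤ)) M (faceFun (α := Bool) q'.1 q'.2) (degenFun q'.1 w) = w := by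
          rw [boxAct_face (neg_cast_le M)]
          have : (fun j => clamp (-(M : ℤ)) M (degenFun q'.1 w j)) = degenFun q'.1 w :=
            funext fun j => clamp_eq_self (hw _).1 (hw _).2
          rw [this]
          change faceFun q'.1 (endpt M q'.2) _ = w
          rw [← h', faceFun_degenFun]
        have e₃ : boxAct (-(M : ℤ)) M (degenFun (α := Bool) q.1) w = degenFun q.1 w := by
          rw [boxAct_degen (neg_cast_le M), hw']
        refine (boxAct_comp (neg_cast_le M) (IsBoxMap.degen q'.1).monotone
          ((IsBoxMap.face q'.1 q'.2).comp (IsBoxMap.degen q.1)).monotone w).trans ?_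
        rw [e₁]
        refine (boxAct_comp (neg_cast_le M) (IsBoxMap.face q'.1 q'.2).monotone
          (IsBoxMap.degen q.1).monotone _).trans ?_
        rw [e₂, e₃]
      have := congrFun (congrArg Subtype.val (hc q q' hq hq' e)) w
      rw [nerve_map_apply G _ _ (hM q hq), nerve_map_apply G _ _ (hM q' hq')] at this
      rw [← key q q' h', ← key q' q h]
      exact this
  -- The choice of face is harmless: by `compat`, every face containing the retracted point gives
  -- the same value.
  choose Q hQ hQ' using fun w : Fin (n + 1) → ℤ => exists_face (p := p) hM₀ w
  let F : (Fin (n + 1) → ℤ) → V :=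
    fun w => (c (Q w) (hQ w)).1 (degenFun (Q w).1 (openBoxRetract p M w))
  have hF : ∀ w q hq, openBoxRetract p M w q.1 = endpt M q.2 →
      F w = (c q hq).1 (degenFun q.1 (openBoxRetract p M w)) := fun w q hq h =>
    compat _ (openBoxRetract_mem w) _ _ _ _ (hQ' w) h
  have F_bdd : BoundedBy F (3 * M) := fun w => by
    have e := openBoxRetract_clamp (p := p) (M := M) w
    rw [hF _ (Q w) (hQ w) (by rw [e]; exact hQ' w), e]
  have F_graph : IsGraphMap (grid ℤ (n + 1)) G F := by
    refine isGraphMap_of_succ fun v w a h ha => ?_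
    obtain ⟨q, hq, hv, hw, b, hb, hb₁, hb₂⟩ := exists_common_face (p := p) hM₀ h ha
    rw [hF v q hq hv, hF w q hq hw]
    by_cases hbq : b = q.1
    · refine Or.inr (congrArg _ (funext fun j => hb _ ?_))
      rw [hbq]
      exact Fin.succAbove_ne _ _
    · obtain ⟨b', rfl⟩ := Fin.exists_succAbove_eq hbq
      refine (c q hq).2.1.adj_or_eq_of_near b' (fun j hj => hb _ ?_) hb₁ hb₂
      exact fun e => hj (Fin.succAbove_right_injective e)
  refine ⟨⟨F, F_graph, fun i ε => F_bdd.isStableIn i ε⟩, fun q hq => ?_⟩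
  refine Subtype.ext (funext fun v => ?_)
  refine (nerve_map_apply G (Box.face q.1 q.2).op _ F_bdd v).trans ?_
  change F (boxAct _ _ (faceFun q.1 q.2) v) = _
  rw [boxAct_face (neg_cast_le _)]
  change F (faceFun q.1 (endpt (3 * M) q.2) _) = _
  have e := openBoxRetract_eq_clamp hq
    (faceFun_self q.1 (endpt (3 * M) q.2) fun j => clamp (-((3 * M : ℕ) : ℤ)) (3 * M : ℕ) (v j))
  rw [hF _ q hq, e]
  · refine Eq.trans ?_ (hM q hq v)
    refine congrArg (c q hq).1 (funext fun j => ?_)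
    simp only [degenFun, faceFun_succAbove, clamp]
    omega
  · rw [e]
    simp only [faceFun_self]
    cases q.2 <;> simp [endpt, clamp] <;> omega

/-- A map out of the open box is determined by its values on the faces. These are compatible by
naturality, because fixing coordinates in two different directions commutes. -/
theorem isKanComplex_nerve {V : Type u} (G : SimpleGraph V) : IsKanComplex (nerve G) := by
  intro A B i hi
  simp only [openBoxInclusions, MorphismProperty.iSup_iff] at hi
  obtain ⟨n, ⟨p⟩⟩ := hi
  refine ⟨fun {t b} sq => ⟨?_⟩⟩
  have mem : ∀ q ≠ p, ULift.up (Box.face q.1 q.2) ∈ (openBox.{u} n p).obj (op (Box.mk n)) :=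
    fun q hq => (mem_openBox_iff p _).2 ⟨q, hq, fun x => faceFun_self _ _ _⟩
  have nat : ∀ {k m : ℕ} (φ : Box.mk k ⟶ Box.mk (n + 1)) (ψ : Box.mk m ⟶ Box.mk k)
      (h : ULift.up φ ∈ (openBox.{u} n p).obj (op (Box.mk k)))
      (h' : ULift.up (ψ ≫ φ) ∈ (openBox.{u} n p).obj (op (Box.mk m))),
      t.app (op (Box.mk m)) ⟨ULift.up (ψ ≫ φ), h'⟩ =
        (nerve G).map ψ.op (t.app (op (Box.mk k)) ⟨ULift.up φ, h⟩) := fun φ ψ h h' =>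
    t.naturality_apply ψ.op ⟨ULift.up φ, h⟩
  obtain ⟨F, hF⟩ := exists_filler G p
    (fun q hq => t.app (op (Box.mk n)) ⟨ULift.up (Box.face q.1 q.2), mem q hq⟩)
    (fun q q' hq hq' hne => by
      have comm : (Box.degen q'.1 ≫ Box.face q'.1 q'.2 ≫ Box.degen q.1) ≫ Box.face q.1 q.2 =
          (Box.degen q.1 ≫ Box.face q.1 q.2 ≫ Box.degen q'.1) ≫ Box.face q'.1 q'.2 := by
        have upd : ∀ (q : Fin (n + 1) × Bool) (x : Fin (n + 1) → Bool),
            faceFun q.1 q.2 (degenFun q.1 x) = Function.update x q.1 q.2 := by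
          intro q x
          funext j
          by_cases hj : j = q.1
          · rw [hj, faceFun_self, Function.update_self]
          · obtain ⟨j, rfl⟩ := Fin.exists_succAbove_eq hj
            rw [faceFun_succAbove, Function.update_of_ne (Fin.succAbove_ne _ _)]
            rfl
        refine Box.hom_ext fun x => ?_
        change faceFun q.1 q.2 (degenFun q.1 (faceFun q'.1 q'.2 (degenFun q'.1 x))) =
          faceFun q'.1 q'.2 (degenFun q'.1 (faceFun q.1 q.2 (degenFun q.1 x)))
        rw [upd, upd, upd, upd, Function.update_comm hne]
      have h₁ : ULift.up ((Box.degen q'.1 ≫ Box.face q'.1 q'.2 ≫ Box.degen q.1) ≫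
          Box.face q.1 q.2) ∈ (openBox.{u} n p).obj (op (Box.mk (n + 1))) :=
        (mem_openBox_iff p _).2 ⟨q, hq, fun x => faceFun_self _ _ _⟩
      have h₂ : ULift.up ((Box.degen q.1 ≫ Box.face q.1 q.2 ≫ Box.degen q'.1) ≫
          Box.face q'.1 q'.2) ∈ (openBox.{u} n p).obj (op (Box.mk (n + 1))) := comm ▸ h₁
      rw [← nat _ _ _ h₁, ← nat _ _ _ h₂]
      exact congrArg (t.app _) (Subtype.ext (congrArg ULift.up comm)))
  refine ⟨
    { l := uliftYonedaEquiv.symm F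
      fac_left := ?_
      fac_right := Limits.terminal.hom_ext _ _ }⟩
  ext ⟨⟨k⟩⟩ ⟨⟨φ⟩, hφ⟩
  obtain ⟨q, hq, h⟩ := (mem_openBox_iff p φ).1 hφ
  have e := Box.eq_comp_face h
  change (nerve G).map φ.op F = t.app _ ⟨ULift.up φ, hφ⟩
  have hφ' : ULift.up ((φ ≫ Box.degen q.1) ≫ Box.face q.1 q.2) ∈
      (openBox.{u} n p).obj (op (Box.mk k)) := e ▸ hφ
  have e' : (⟨ULift.up φ, hφ⟩ : (openBox.{u} n p).toFunctor.obj (op (Box.mk k))) =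
      ⟨ULift.up ((φ ≫ Box.degen q.1) ≫ Box.face q.1 q.2), hφ'⟩ :=
    Subtype.ext (congrArg ULift.up e)
  rw [e', nat _ _ (mem q hq), ← hF q hq, ← cubes_map_comp, ← e]

/-! ### Pushing coordinates away from an end point -/

section Push

/-- The end points of `I_m`. -/
def side (m : ℕ) (ε : Bool) : Fin (m + 1) := if ε then Fin.last m else 0

/-- The map `I_{m+1} → I_{m+1}` that moves the end point `side (m + 1) δ` to its neighbour and
fixes everything else. -/
def inward {m : ℕ} (δ : Bool) (t : Fin (m + 2)) : Fin (m + 2) :=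
  if δ then ⟨min t.1 m, by omega⟩ else ⟨max t.1 1, by omega⟩

/-- Applies `inward δ` to the coordinates from the `c`-th on. -/
def inwardFrom {m n : ℕ} (δ : Bool) (c : ℕ) (v : Fin n → Fin (m + 2)) (i : Fin n) : Fin (m + 2) :=
  if c ≤ i.1 then inward δ (v i) else v i

variable {m n : ℕ} (δ : Bool)

theorem inward_val (t : Fin (m + 2)) : (inward δ t).1 = if δ then min t.1 m else max t.1 1 := by
  cases δ <;> rfl

theorem side_val (m : ℕ) (ε : Bool) : (side m ε).1 = if ε then m else 0 := by
  cases ε <;> rfl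

theorem inward_inward (t : Fin (m + 2)) : inward δ (inward δ t) = inward δ t := by
  rw [Fin.ext_iff, inward_val, inward_val]
  split_ifs <;> omega

/-- For `m = 0` this fails: the neighbour of one end point is the other end point. -/
theorem inward_eq_side_iff (hm : 0 < m) (t : Fin (m + 2)) :
    inward δ t = side (m + 1) (!δ) ↔ t = side (m + 1) (!δ) := by
  rw [Fin.ext_iff, Fin.ext_iff, inward_val, side_val]
  cases δ <;> simp <;> omega

theorem inward_mono : Monotone (inward (m := m) δ) := by
  intro a b h
  rw [Fin.le_def] at h ⊢
  rw [inward_val, inward_val]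
  split_ifs <;> omega

theorem inward_connOp (ε : Bool) (a b : Fin (m + 2)) :
    inward δ (connOp ε a b) = connOp ε (inward δ a) (inward δ b) := by
  cases ε
  · exact (inward_mono δ).map_max
  · exact (inward_mono δ).map_min

theorem isGraphMap_inward :
    IsGraphMap (SimpleGraph.hasse (Fin (m + 2))) (SimpleGraph.hasse _) (inward δ) :=
  isGraphMap_of_finCovBy fun x y h => by
    rw [inward_val, inward_val]
    split_ifs <;> omega

theorem adj_inward_or_eq (t : Fin (m + 2)) :
    (SimpleGraph.hasse (Fin (m + 2))).Adj t (inward δ t) ∨ t = inward δ t := by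
  rw [SimpleGraph.hasse_adj, Fin.covBy_iff, Fin.covBy_iff, Nat.covBy_iff_add_one_eq,
    Nat.covBy_iff_add_one_eq, Fin.ext_iff, inward_val]
  split_ifs <;> omega

theorem side_ne_side_not (m : ℕ) (ε : Bool) : side (m + 1) ε ≠ side (m + 1) (!ε) := by
  cases ε <;> simp [side, Fin.ext_iff]

theorem connOp_side (ε : Bool) (t : Fin (m + 1)) : connOp ε (side m ε) t = t := by
  cases ε
  · simp [connOp, side]
  · simp [connOp, side, Fin.le_last]

theorem connOp_eq_side_iff (s t : Fin (m + 1)) :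
    connOp δ s t = side m (!δ) ↔ s = side m (!δ) ∨ t = side m (!δ) := by
  have h₁ := s.2
  have h₂ := t.2
  cases δ
  · simp only [connOp, side, Fin.ext_iff, Fin.coe_max, Bool.false_eq_true, if_false, Bool.not_false,
      if_true, Fin.val_last]
    omega
  · simp only [connOp, side, Fin.ext_iff, Fin.coe_min, Bool.false_eq_true, if_false, Bool.not_true,
      if_true, Fin.val_zero]
    omega

theorem inwardFrom_comm (c d : ℕ) (v : Fin n → Fin (m + 2)) :
    inwardFrom δ c (inwardFrom δ d v) = inwardFrom δ d (inwardFrom δ c v) := by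
  funext i
  simp only [inwardFrom]
  split_ifs <;> rfl

theorem inwardFrom_self (c : ℕ) (v : Fin n → Fin (m + 2)) :
    inwardFrom δ c (inwardFrom δ c v) = inwardFrom δ c v := by
  funext i
  simp only [inwardFrom]
  split_ifs <;> simp [inward_inward]

theorem inwardFrom_of_le {c : ℕ} (h : n ≤ c) (v : Fin n → Fin (m + 2)) : inwardFrom δ c v = v := by
  funext i
  rw [inwardFrom, if_neg (by omega)]

theorem isGraphMap_inwardFrom (c : ℕ) :
    IsGraphMap (grid (Fin (m + 2)) n) (grid (Fin (m + 2)) n) (inwardFrom δ c) := by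
  rintro v w ⟨i, h, h'⟩
  have hj : ∀ j, j ≠ i → inwardFrom δ c v j = inwardFrom δ c w j := fun j hj => by
    rw [inwardFrom, inwardFrom, h' j hj]
  have hi : (SimpleGraph.hasse (Fin (m + 2))).Adj (inwardFrom δ c v i) (inwardFrom δ c w i) ∨
      inwardFrom δ c v i = inwardFrom δ c w i := by
    simp only [inwardFrom]
    split_ifs
    · exact isGraphMap_inward δ h
    · exact Or.inl h
  refine hi.imp (fun hi => ⟨i, hi, hj⟩) fun hi => funext fun j => ?_
  by_cases e : j = i
  · rw [e, hi]
  · exact hj j e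

theorem degenFun_last_inwardFrom (c : ℕ) (v : Fin (n + 1) → Fin (m + 2)) :
    degenFun (Fin.last n) (inwardFrom δ c v) = inwardFrom δ c (degenFun (Fin.last n) v) := by
  funext i
  simp [degenFun, inwardFrom]

theorem inwardFrom_last_eq_iff (hm : 0 < m) (c : ℕ) (v : Fin (n + 1) → Fin (m + 2)) :
    inwardFrom δ c v (Fin.last n) = side (m + 1) (!δ) ↔ v (Fin.last n) = side (m + 1) (!δ) := by
  rw [inwardFrom]
  split_ifs
  · exact inward_eq_side_iff δ hm _
  · rfl

end Push

/-! ### Actions on cubes of finite nerves, cutoffs and pushing homotopies -/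

section Cubes

variable {V : Type u} {G : SimpleGraph V} {m n : ℕ}

theorem finiteNerve_map_face (i : Fin (n + 1)) (ε : Bool) (f : Cubes (finiteNerve m G) (n + 1))
    (v : Fin n → Fin (m + 1)) :
    ((finiteNerve m G).map (Box.face i ε).op f).1 v = f.1 (faceFun i (side m ε) v) := by
  refine congrArg f.1 ((boxAct_face (Fin.zero_le _) i ε v).trans ?_)
  exact congrArg _ (funext fun j => clamp_eq_self (Fin.zero_le _) (Fin.le_last _))

theorem finiteNerve_map_degen (i : Fin (n + 1)) (f : Cubes (finiteNerve m G) n)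
    (v : Fin (n + 1) → Fin (m + 1)) :
    ((finiteNerve m G).map (Box.degen i).op f).1 v = f.1 (degenFun i v) := by
  refine congrArg f.1 ((boxAct_degen (Fin.zero_le _) i v).trans ?_)
  exact congrArg _ (funext fun j => clamp_eq_self (Fin.zero_le _) (Fin.le_last _))

theorem finiteNerve_map_conn (i : Fin (n + 1)) (ε : Bool) (f : Cubes (finiteNerve m G) (n + 1))
    (v : Fin (n + 2) → Fin (m + 1)) :
    ((finiteNerve m G).map (Box.conn i ε).op f).1 v = f.1 (connFun i ε v) := by
  refine congrArg f.1 ((boxAct_conn (Fin.zero_le _) i ε v).trans ?_)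
  exact congrArg _ (funext fun j => clamp_eq_self (Fin.zero_le _) (Fin.le_last _))

variable (δ : Bool)

/-- Pushing the coordinates from the `c`-th on inward moves the values of `f` at most to adjacent
vertices. -/
def AdmFrom (f : Cubes (finiteNerve (m + 1) G) n) (c : ℕ) : Prop :=
  ∀ v, G.Adj (f.1 v) (f.1 (inwardFrom δ c v)) ∨ f.1 v = f.1 (inwardFrom δ c v)

theorem admFrom_self (f : Cubes (finiteNerve (m + 1) G) n) : AdmFrom δ f n := fun v =>
  Or.inr (congrArg f.1 (inwardFrom_of_le δ le_rfl v).symm)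

open Classical in
/-- The least `c` such that `f` may be pushed inward from the `c`-th coordinate on. -/
noncomputable def cutoff (f : Cubes (finiteNerve (m + 1) G) n) : ℕ :=
  Nat.find ⟨n, admFrom_self δ f⟩

theorem admFrom_cutoff (f : Cubes (finiteNerve (m + 1) G) n) : AdmFrom δ f (cutoff δ f) := by
  classical exact Nat.find_spec (⟨n, admFrom_self δ f⟩ : ∃ c, AdmFrom δ f c)

variable {δ} in
theorem cutoff_le {f : Cubes (finiteNerve (m + 1) G) n} {c : ℕ} (h : AdmFrom δ f c) :
    cutoff δ f ≤ c := by
  classical exact Nat.find_min' _ h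

/-- The homotopy that pushes the coordinates of `f` from the `c`-th on inward. -/
def cyl (f : Cubes (finiteNerve (m + 1) G) n) (c : ℕ) (h : AdmFrom δ f c) :
    Cubes (finiteNerve (m + 1) G) (n + 1) :=
  ⟨fun v => if v (Fin.last n) = side (m + 1) (!δ) then
      f.1 (inwardFrom δ c (degenFun (Fin.last n) v))
    else f.1 (degenFun (Fin.last n) v), by
    rintro v w ⟨i, hi, hvw⟩
    dsimp only
    by_cases hil : i = Fin.last n
    · have e : degenFun (Fin.last n) v = degenFun (Fin.last n) w := funext fun j =>
        hvw _ (hil ▸ Fin.succAbove_ne _ _)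
      rw [e]
      split_ifs
      · exact Or.inr rfl
      · exact (h _).imp SimpleGraph.Adj.symm Eq.symm
      · exact h _
      · exact Or.inr rfl
    · obtain ⟨j, rfl⟩ := Fin.exists_succAbove_eq hil
      have e : (grid (Fin (m + 2)) n).Adj (degenFun (Fin.last n) v) (degenFun (Fin.last n) w) :=
        ⟨j, hi, fun k hk => hvw _ fun e => hk (Fin.succAbove_right_injective e)⟩
      rw [hvw _ (Ne.symm hil)]
      split_ifs
      · exact f.2.comp (isGraphMap_inwardFrom δ c) e
      · exact f.2 e⟩

theorem cyl_apply (f : Cubes (finiteNerve (m + 1) G) n) (c : ℕ) (h : AdmFrom δ f c)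
    (v : Fin (n + 1) → Fin (m + 2)) :
    (cyl δ f c h).1 v = if v (Fin.last n) = side (m + 1) (!δ) then
      f.1 (inwardFrom δ c (degenFun (Fin.last n) v)) else f.1 (degenFun (Fin.last n) v) := rfl

theorem cyl_faceFun (f : Cubes (finiteNerve (m + 1) G) n) (c : ℕ) (h : AdmFrom δ f c)
    {t : Fin (m + 2)} (ht : t ≠ side (m + 1) (!δ)) (v : Fin n → Fin (m + 2)) :
    (cyl δ f c h).1 (faceFun (Fin.last n) t v) = f.1 v := by
  rw [cyl_apply, faceFun_self, if_neg ht, degenFun_faceFun]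

theorem cyl_face (f : Cubes (finiteNerve (m + 1) G) n) (c : ℕ) (h : AdmFrom δ f c) :
    (finiteNerve (m + 1) G).map (Box.face (Fin.last n) δ).op (cyl δ f c h) = f :=
  Subtype.ext (funext fun v => (finiteNerve_map_face _ _ _ v).trans
    (cyl_faceFun δ f c h (side_ne_side_not m δ) v))

theorem cyl_face_not (f : Cubes (finiteNerve (m + 1) G) n) (c : ℕ) (h : AdmFrom δ f c)
    (v : Fin n → Fin (m + 2)) :
    ((finiteNerve (m + 1) G).map (Box.face (Fin.last n) (!δ)).op (cyl δ f c h)).1 v =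
      f.1 (inwardFrom δ c v) := by
  rw [finiteNerve_map_face, cyl_apply, faceFun_self, if_pos rfl, degenFun_faceFun]

/-- Pushing never changes whether the last coordinate is at the end where the homotopy acts, and
pushes from different positions commute. -/
theorem admFrom_cyl_iff (hm : 0 < m) (f : Cubes (finiteNerve (m + 1) G) n) (c : ℕ)
    (h : AdmFrom δ f c) (d : ℕ) : AdmFrom δ (cyl δ f c h) d ↔ AdmFrom δ f d := by
  constructor
  · intro hd v
    have := hd (faceFun (Fin.last n) (side (m + 1) δ) v)
    rw [cyl_faceFun δ f c h (side_ne_side_not m δ), cyl_apply,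
      if_neg (by rw [inwardFrom_last_eq_iff δ hm, faceFun_self]; exact side_ne_side_not m δ),
      degenFun_last_inwardFrom, degenFun_faceFun] at this
    exact this
  · intro hd v
    simp only [cyl_apply, inwardFrom_last_eq_iff δ hm, degenFun_last_inwardFrom]
    split_ifs
    · rw [inwardFrom_comm δ c d]
      exact hd _
    · exact hd _

theorem cutoff_cyl (hm : 0 < m) (f : Cubes (finiteNerve (m + 1) G) n) (c : ℕ)
    (h : AdmFrom δ f c) : cutoff δ (cyl δ f c h) = cutoff δ f :=
  le_antisymm (cutoff_le ((admFrom_cyl_iff δ hm f c h _).2 (admFrom_cutoff δ f)))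
    (cutoff_le ((admFrom_cyl_iff δ hm f c h _).1 (admFrom_cutoff δ _)))

/-- The homotopy that pushes as many coordinates of `f` inward as possible. -/
noncomputable def maxCyl (f : Cubes (finiteNerve (m + 1) G) n) :
    Cubes (finiteNerve (m + 1) G) (n + 1) :=
  cyl δ f (cutoff δ f) (admFrom_cutoff δ f)

theorem cyl_eq_maxCyl (f : Cubes (finiteNerve (m + 1) G) n) {c : ℕ} (h : AdmFrom δ f c)
    (hc : c = cutoff δ f) : cyl δ f c h = maxCyl δ f := by
  subst hc
  rfl

theorem maxCyl_apply (f : Cubes (finiteNerve (m + 1) G) n) (v : Fin (n + 1) → Fin (m + 2)) :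
    (maxCyl δ f).1 v = if v (Fin.last n) = side (m + 1) (!δ) then
      f.1 (inwardFrom δ (cutoff δ f) (degenFun (Fin.last n) v))
      else f.1 (degenFun (Fin.last n) v) := rfl

/-! ### Compatibility with degeneracies and connections -/

theorem degenFun_surjective {α : Type*} [Nonempty α] (i : Fin (n + 1)) :
    Function.Surjective (degenFun (α := α) i) :=
  fun w => ⟨faceFun i (Classical.arbitrary α) w, degenFun_faceFun _ _ _⟩

theorem degenFun_inwardFrom (i : Fin (n + 1)) (c : ℕ) (v : Fin (n + 1) → Fin (m + 2)) :
    degenFun i (inwardFrom δ c v) =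
      inwardFrom δ (if c ≤ i.1 then c else c - 1) (degenFun i v) := by
  funext j
  simp only [degenFun_apply, inwardFrom]
  split_ifs <;> first | rfl | omega

theorem admFrom_degen_iff (i : Fin (n + 1)) (f : Cubes (finiteNerve (m + 1) G) n) (c : ℕ) :
    AdmFrom δ ((finiteNerve (m + 1) G).map (Box.degen i).op f) c ↔
      AdmFrom δ f (if c ≤ i.1 then c else c - 1) := by
  simp only [AdmFrom, finiteNerve_map_degen, degenFun_inwardFrom]
  exact ⟨fun h w => by
    obtain ⟨v, rfl⟩ := degenFun_surjective i w
    exact h v, fun h v => h _⟩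

/-- The left side is the position at which pushing occurs once the `i`-th coordinate has been
deleted, in the form needed after `degenFun_inwardFrom`. -/
theorem cutoff_degen (i : Fin (n + 1)) (f : Cubes (finiteNerve (m + 1) G) n) :
    (if cutoff δ ((finiteNerve (m + 1) G).map (Box.degen i).op f) ≤ i.1 then
      cutoff δ ((finiteNerve (m + 1) G).map (Box.degen i).op f)
      else cutoff δ ((finiteNerve (m + 1) G).map (Box.degen i).op f) - 1) = cutoff δ f := by
  refine le_antisymm ?_ (cutoff_le ((admFrom_degen_iff δ i f _).1 (admFrom_cutoff δ _)))
  have h := admFrom_cutoff δ f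
  have : cutoff δ ((finiteNerve (m + 1) G).map (Box.degen i).op f) ≤
      if cutoff δ f ≤ i.1 then cutoff δ f else cutoff δ f + 1 := by
    refine cutoff_le ((admFrom_degen_iff δ i f _).2 ?_)
    convert h using 1
    grind
  grind

theorem maxCyl_degen (i : Fin (n + 1)) (f : Cubes (finiteNerve (m + 1) G) n) :
    maxCyl δ ((finiteNerve (m + 1) G).map (Box.degen i).op f) =
      (finiteNerve (m + 1) G).map (Box.degen i.castSucc).op (maxCyl δ f) := by
  refine Subtype.ext (funext fun v => ?_)
  have e₁ : degenFun i.castSucc v (Fin.last n) = v (Fin.last (n + 1)) := by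
    simp [degenFun]
  have e₂ : degenFun (Fin.last n) (degenFun i.castSucc v) =
      degenFun i (degenFun (Fin.last (n + 1)) v) := by
    funext j
    simp only [degenFun_apply, Fin.val_castSucc, Fin.val_last]
    split_ifs <;> first | rfl | omega
  rw [finiteNerve_map_degen, maxCyl_apply, maxCyl_apply, finiteNerve_map_degen,
    finiteNerve_map_degen, degenFun_inwardFrom, cutoff_degen, e₁, e₂]

/-- The excluded value would push only one of the two coordinates merged by the connection. If both
or neither are pushed, monotonicity of `inward` lets it pass through `max` and `min`. -/
theorem connFun_inwardFrom (i : Fin (n + 1)) (ε : Bool) {c : ℕ} (hc : c ≠ i.1 + 1)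
    (v : Fin (n + 2) → Fin (m + 2)) :
    connFun i ε (inwardFrom δ c v) =
      inwardFrom δ (if c ≤ i.1 then c else c - 1) (connFun i ε v) := by
  funext j
  simp only [connFun_apply, inwardFrom]
  split_ifs <;> first | rfl | omega | exact (inward_connOp δ ε _ _).symm

theorem connFun_faceFun_side (i : Fin (n + 1)) (ε : Bool) (v : Fin (n + 1) → Fin (m + 1)) :
    connFun i ε (faceFun i.castSucc (side m ε) v) = v := by
  funext j
  simp only [connFun_apply, faceFun_apply, Fin.val_castSucc]
  grind [connOp_side]

theorem connFun_inwardFrom_faceFun_side (i : Fin (n + 1)) (ε : Bool)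
    (v : Fin (n + 1) → Fin (m + 2)) :
    connFun i ε (inwardFrom δ (i.1 + 1) (faceFun i.castSucc (side (m + 1) ε) v)) =
      inwardFrom δ i.1 v := by
  funext j
  simp only [connFun_apply, inwardFrom, faceFun_apply, Fin.val_castSucc]
  grind [connOp_side]

theorem admFrom_conn_iff (i : Fin (n + 1)) (ε : Bool) (f : Cubes (finiteNerve (m + 1) G) (n + 1))
    {c : ℕ} (hc : c ≠ i.1 + 1) :
    AdmFrom δ ((finiteNerve (m + 1) G).map (Box.conn i ε).op f) c ↔
      AdmFrom δ f (if c ≤ i.1 then c else c - 1) := by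
  simp only [AdmFrom, finiteNerve_map_conn, connFun_inwardFrom δ i ε hc]
  exact ⟨fun h w => by
    have := h (faceFun i.castSucc (side (m + 1) ε) w)
    rwa [connFun_faceFun_side] at this, fun h v => h _⟩

/-- Minimality is essential: if pushing from `i + 1` is admissible, setting the first merged
coordinate to the neutral end shows that `f` may be pushed from `i`, hence so may its connection. -/
theorem cutoff_conn_ne (i : Fin (n + 1)) (ε : Bool) (f : Cubes (finiteNerve (m + 1) G) (n + 1)) :
    cutoff δ ((finiteNerve (m + 1) G).map (Box.conn i ε).op f) ≠ i.1 + 1 := by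
  intro e
  have h := admFrom_cutoff δ ((finiteNerve (m + 1) G).map (Box.conn i ε).op f)
  rw [e] at h
  have h' : AdmFrom δ f i.1 := fun w => by
    have := h (faceFun i.castSucc (side (m + 1) ε) w)
    rwa [finiteNerve_map_conn, finiteNerve_map_conn, connFun_inwardFrom_faceFun_side,
      connFun_faceFun_side] at this
  have := cutoff_le ((admFrom_conn_iff δ i ε f (c := i.1) (by omega)).2 (by rwa [if_pos le_rfl]))
  omega

theorem cutoff_conn (i : Fin (n + 1)) (ε : Bool) (f : Cubes (finiteNerve (m + 1) G) (n + 1)) :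
    (if cutoff δ ((finiteNerve (m + 1) G).map (Box.conn i ε).op f) ≤ i.1 then
      cutoff δ ((finiteNerve (m + 1) G).map (Box.conn i ε).op f)
      else cutoff δ ((finiteNerve (m + 1) G).map (Box.conn i ε).op f) - 1) = cutoff δ f := by
  have hne := cutoff_conn_ne δ i ε f
  refine le_antisymm ?_ (cutoff_le ((admFrom_conn_iff δ i ε f hne).1 (admFrom_cutoff δ _)))
  have h := admFrom_cutoff δ f
  have : cutoff δ ((finiteNerve (m + 1) G).map (Box.conn i ε).op f) ≤
      if cutoff δ f ≤ i.1 then cutoff δ f else cutoff δ f + 1 := by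
    refine cutoff_le ((admFrom_conn_iff δ i ε f ?_).2 ?_)
    · grind
    · convert h using 1
      grind
  grind

theorem maxCyl_conn (i : Fin (n + 1)) (ε : Bool) (f : Cubes (finiteNerve (m + 1) G) (n + 1)) :
    maxCyl δ ((finiteNerve (m + 1) G).map (Box.conn i ε).op f) =
      (finiteNerve (m + 1) G).map (Box.conn i.castSucc ε).op (maxCyl δ f) := by
  refine Subtype.ext (funext fun v => ?_)
  have e₁ : connFun i.castSucc ε v (Fin.last (n + 1)) = v (Fin.last (n + 2)) := by
    rw [connFun_apply, if_neg (by simp), if_neg (by simp; omega)]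
    rfl
  have e₂ : degenFun (Fin.last (n + 1)) (connFun i.castSucc ε v) =
      connFun i ε (degenFun (Fin.last (n + 2)) v) := by
    funext j
    simp only [degenFun_apply, connFun_apply, Fin.val_castSucc, Fin.val_last]
    grind
  rw [finiteNerve_map_conn, maxCyl_apply, maxCyl_apply, finiteNerve_map_conn,
    finiteNerve_map_conn, connFun_inwardFrom δ i ε (cutoff_conn_ne δ i ε f), cutoff_conn, e₁, e₂]

/-- Both cutoffs agree and pushing is idempotent, so the double homotopy is pushed exactly when one
of the last two coordinates is at the end `!δ`. That end is absorbing for the connection. -/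
theorem maxCyl_maxCyl (hm : 0 < m) (f : Cubes (finiteNerve (m + 1) G) n) :
    maxCyl δ (maxCyl δ f) =
      (finiteNerve (m + 1) G).map (Box.conn (Fin.last n) δ).op (maxCyl δ f) := by
  refine Subtype.ext (funext fun v => ?_)
  have hc : cutoff δ (maxCyl δ f) = cutoff δ f := cutoff_cyl δ hm f _ _
  have e₁ : connFun (Fin.last n) δ v (Fin.last n) =
      connOp δ (degenFun (Fin.last (n + 1)) v (Fin.last n)) (v (Fin.last (n + 1))) := by
    rw [connFun_apply, if_neg (lt_irrefl _), if_pos rfl, degenFun_apply]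
    simp
    rfl
  have e₂ : degenFun (Fin.last n) (connFun (Fin.last n) δ v) =
      degenFun (Fin.last n) (degenFun (Fin.last (n + 1)) v) := by
    funext j
    simp only [degenFun_apply, connFun_apply, Fin.val_last]
    grind
  rw [finiteNerve_map_conn, maxCyl_apply, hc, maxCyl_apply, maxCyl_apply, maxCyl_apply,
    degenFun_last_inwardFrom, inwardFrom_self, e₁, e₂]
  simp only [inwardFrom_last_eq_iff δ hm, connOp_eq_side_iff]
  split_ifs <;> first | rfl | (exfalso; tauto)

end Cubes

/-! ### Stable and unstable directions of cubes of finite nerves -/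

section Unstable

variable {V : Type u} {G : SimpleGraph V} {m n : ℕ} (δ : Bool)

/-- Pushing the `k`-th coordinate inward does not change the values of `f`. -/
def IsStableAt (f : Cubes (finiteNerve (m + 1) G) n) (k : Fin n) : Prop :=
  ∀ v, f.1 (Function.update v k (inward δ (v k))) = f.1 v

open Classical in
/-- The directions in which `f` is not stable. -/
noncomputable def unstable (f : Cubes (finiteNerve (m + 1) G) n) : Finset (Fin n) :=
  Finset.univ.filter fun k => ¬ IsStableAt δ f k

variable {δ}

theorem mem_unstable {f : Cubes (finiteNerve (m + 1) G) n} {k : Fin n} :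
    k ∈ unstable δ f ↔ ¬ IsStableAt δ f k := by
  simp [unstable]

theorem IsStableAt.face {f : Cubes (finiteNerve (m + 1) G) (n + 1)} {j : Fin (n + 1)} {ε : Bool}
    {k : Fin n} (h : IsStableAt δ f (j.succAbove k)) :
    IsStableAt δ ((finiteNerve (m + 1) G).map (Box.face j ε).op f) k := by
  intro v
  rw [finiteNerve_map_face, finiteNerve_map_face, ← h (faceFun j _ v)]
  refine congrArg f.1 (funext fun l => ?_)
  refine Fin.succAboveCases j ?_ (fun l => ?_) l
  · rw [faceFun_self, Function.update_of_ne (Fin.succAbove_ne _ _).symm, faceFun_self]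
  · by_cases hl : l = k
    · subst hl
      rw [faceFun_succAbove, faceFun_succAbove, Function.update_self, Function.update_self]
    · rw [faceFun_succAbove, Function.update_of_ne hl, Function.update_of_ne, faceFun_succAbove]
      exact fun e => hl (Fin.succAbove_right_injective e)

theorem map_unstable_face_subset (f : Cubes (finiteNerve (m + 1) G) (n + 1)) (j : Fin (n + 1))
    (ε : Bool) : (unstable δ ((finiteNerve (m + 1) G).map (Box.face j ε).op f)).map
      j.succAboveEmb ⊆ (unstable δ f).erase j := by
  intro k hk
  obtain ⟨k, hk', rfl⟩ := Finset.mem_map.1 hk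
  exact Finset.mem_erase.2 ⟨Fin.succAbove_ne _ _,
    mem_unstable.2 fun h => mem_unstable.1 hk' h.face⟩

theorem card_unstable_face_le (f : Cubes (finiteNerve (m + 1) G) (n + 1)) (j : Fin (n + 1))
    (ε : Bool) : (unstable δ ((finiteNerve (m + 1) G).map (Box.face j ε).op f)).card ≤
      (unstable δ f).card := by
  rw [← Finset.card_map j.succAboveEmb]
  exact Finset.card_le_card
    ((map_unstable_face_subset f j ε).trans (Finset.erase_subset _ _))

theorem card_unstable_face_lt {f : Cubes (finiteNerve (m + 1) G) (n + 1)} {j : Fin (n + 1)}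
    (ε : Bool) (h : j ∈ unstable δ f) :
    (unstable δ ((finiteNerve (m + 1) G).map (Box.face j ε).op f)).card <
      (unstable δ f).card := by
  rw [← Finset.card_map j.succAboveEmb]
  exact (Finset.card_le_card (map_unstable_face_subset f j ε)).trans_lt
    (Finset.card_erase_lt_of_mem h)

theorem IsStableAt.inwardFrom {f : Cubes (finiteNerve (m + 1) G) n} {k : Fin n}
    (h : IsStableAt δ f k) (c : ℕ) (v : Fin n → Fin (m + 2)) :
    f.1 (inwardFrom δ c (Function.update v k (inward δ (v k)))) = f.1 (inwardFrom δ c v) := by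
  rw [← h (DiscreteCubical.inwardFrom δ c v)]
  refine congrArg f.1 (funext fun l => ?_)
  by_cases hl : l = k
  · subst hl
    simp only [DiscreteCubical.inwardFrom, Function.update_self]
    split_ifs <;> rfl
  · simp only [DiscreteCubical.inwardFrom, Function.update_of_ne hl]

theorem inwardFrom_update {k : Fin n} {c : ℕ} (h : c ≤ k.1) (v : Fin n → Fin (m + 2)) :
    inwardFrom δ c (Function.update v k (inward δ (v k))) = inwardFrom δ c v := by
  funext l
  by_cases hl : l = k
  · subst hl
    simp only [inwardFrom, Function.update_self, if_pos h, inward_inward]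
  · simp only [inwardFrom, Function.update_of_ne hl]

theorem inwardFrom_eq_update (k : Fin n) (v : Fin n → Fin (m + 2)) :
    inwardFrom δ k.1 v = Function.update (inwardFrom δ (k.1 + 1) v) k
      (inward δ (inwardFrom δ (k.1 + 1) v k)) := by
  funext l
  by_cases hl : l = k
  · subst hl
    simp [inwardFrom]
  · rw [Function.update_of_ne hl]
    simp only [inwardFrom]
    have : l.1 ≠ k.1 := fun e => hl (Fin.ext e)
    split_ifs <;> first | rfl | omega

theorem apply_inwardFrom_of_stable {f : Cubes (finiteNerve (m + 1) G) n} {c : ℕ}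
    (h : ∀ k : Fin n, c ≤ k.1 → IsStableAt δ f k) (v : Fin n → Fin (m + 2)) :
    f.1 (inwardFrom δ c v) = f.1 v := by
  obtain hc | hc := le_or_gt n c
  · rw [inwardFrom_of_le δ hc]
  · obtain ⟨d, hd⟩ := Nat.exists_eq_add_of_lt hc
    induction d generalizing c with
    | zero =>
      rw [inwardFrom_eq_update ⟨c, hc⟩, h ⟨c, hc⟩ le_rfl, inwardFrom_of_le δ (by simp; omega)]
    | succ d ih =>
      rw [inwardFrom_eq_update ⟨c, hc⟩, h ⟨c, hc⟩ le_rfl]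
      exact ih (fun k hk => h k ((Nat.le_succ c).trans hk)) (by simp; omega) (by simp; omega)

/-- Take the last unstable direction `k`. Pushing the coordinates after it changes no value, and
pushing coordinate `k` itself is at most one step in the grid. -/
theorem exists_cutoff_le {f : Cubes (finiteNerve (m + 1) G) n} (h : (unstable δ f).Nonempty) :
    ∃ k ∈ unstable δ f, cutoff δ f ≤ k.1 := by
  refine ⟨(unstable δ f).max' h, Finset.max'_mem _ h, cutoff_le fun v => ?_⟩
  set k := (unstable δ f).max' h
  have hk : ∀ l : Fin n, k.1 + 1 ≤ l.1 → IsStableAt δ f l := fun l hl => by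
    by_contra hl'
    have := Finset.le_max' _ l (mem_unstable.2 hl')
    rw [Fin.le_def] at this
    omega
  rw [inwardFrom_eq_update, ← apply_inwardFrom_of_stable hk v]
  rcases adj_inward_or_eq δ (inwardFrom δ (k.1 + 1) v k) with e | e
  · refine f.2 ⟨k, ?_, fun j hj => (Function.update_of_ne hj _ _).symm⟩
    rwa [Function.update_self]
  · rw [← e, Function.update_eq_self]
    exact Or.inr rfl

/-- The homotopy direction is itself stable: pushing inward moves no point onto or off the end `!δ`,
where alone the value may change. Stable directions of `f` remain stable. -/
theorem card_unstable_cyl_le (hm : 0 < m) (f : Cubes (finiteNerve (m + 1) G) n) (c : ℕ)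
    (h : AdmFrom δ f c) : (unstable δ (cyl δ f c h)).card ≤ (unstable δ f).card := by
  rw [← Finset.card_map (Fin.last n).succAboveEmb]
  refine Finset.card_le_card fun k hk => ?_
  have hk := mem_unstable.1 hk
  have hkl : k ≠ Fin.last n := by
    rintro rfl
    refine hk fun v => ?_
    have e : degenFun (Fin.last n) (Function.update v (Fin.last n)
        (inward δ (v (Fin.last n)))) = degenFun (Fin.last n) v := funext fun j =>
      Function.update_of_ne (Fin.succAbove_ne _ _) _ _
    rw [cyl_apply, cyl_apply, Function.update_self, e]
    simp only [inward_eq_side_iff δ hm]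
  obtain ⟨k, rfl⟩ := Fin.exists_succAbove_eq hkl
  refine Finset.mem_map.2 ⟨k, mem_unstable.2 fun hk' => hk fun v => ?_, rfl⟩
  have e : degenFun (Fin.last n) (Function.update v ((Fin.last n).succAbove k)
      (inward δ (v ((Fin.last n).succAbove k)))) =
      Function.update (degenFun (Fin.last n) v) k (inward δ (degenFun (Fin.last n) v k)) := by
    funext l
    by_cases hl : l = k
    · subst hl
      rw [Function.update_self, degenFun, Function.update_self]
      rfl
    · rw [Function.update_of_ne hl, degenFun, Function.update_of_ne]
      · rfl
      · exact fun e => hl (Fin.succAbove_right_injective e)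
  rw [cyl_apply, cyl_apply, Function.update_of_ne (Fin.succAbove_ne _ _).symm, e, hk',
    hk'.inwardFrom]

theorem mem_unstable_cyl {f : Cubes (finiteNerve (m + 1) G) n} (c : ℕ)
    (h : AdmFrom δ f c) {k : Fin n} (hk : k ∈ unstable δ f) :
    (Fin.last n).succAbove k ∈ unstable δ (cyl δ f c h) := by
  refine mem_unstable.2 fun hk' => mem_unstable.1 hk ?_
  have := hk'.face (ε := δ)
  rwa [cyl_face] at this

/-- At least one unstable direction is at or beyond the cutoff. It becomes stable because pushing is
idempotent, and no stable direction is lost. -/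
theorem card_unstable_face_maxCyl_lt {f : Cubes (finiteNerve (m + 1) G) n}
    (h : (unstable δ f).Nonempty) :
    (unstable δ ((finiteNerve (m + 1) G).map (Box.face (Fin.last n) (!δ)).op
      (maxCyl δ f))).card < (unstable δ f).card := by
  obtain ⟨k, hk, hk'⟩ := exists_cutoff_le h
  refine (Finset.card_le_card (t := (unstable δ f).erase k) fun l hl => ?_).trans_lt
    (Finset.card_erase_lt_of_mem hk)
  refine Finset.mem_erase.2 ⟨?_, mem_unstable.2 fun hl' => mem_unstable.1 hl fun v => ?_⟩
  · rintro rfl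
    refine mem_unstable.1 hl fun v => ?_
    rw [maxCyl, cyl_face_not, cyl_face_not, inwardFrom_update hk']
  · rw [maxCyl, cyl_face_not, cyl_face_not, hl'.inwardFrom]

/-- By stability it does not matter whether the inserted coordinate is pushed as well. -/
theorem inwardFrom_faceFun {f : Cubes (finiteNerve (m + 1) G) (n + 1)} {j : Fin (n + 1)}
    (h : IsStableAt δ f j) (c : ℕ) (t : Fin (m + 2)) (v : Fin n → Fin (m + 2)) :
    f.1 (inwardFrom δ c (faceFun j t v)) =
      f.1 (faceFun j t (inwardFrom δ (if c ≤ j.1 then c else c - 1) v)) := by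
  by_cases hc : c ≤ j.1
  · rw [← h (faceFun j t _), if_pos hc]
    refine congrArg f.1 (funext fun l => ?_)
    by_cases hl : l = j
    · subst hl
      rw [Function.update_self, faceFun_self, inwardFrom, if_pos hc, faceFun_self]
    · have : l.1 ≠ j.1 := fun e => hl (Fin.ext e)
      rw [Function.update_of_ne hl]
      simp only [inwardFrom, faceFun_apply]
      split_ifs <;> first | rfl | omega
  · rw [if_neg hc]
    refine congrArg f.1 (funext fun l => ?_)
    simp only [inwardFrom, faceFun_apply]
    split_ifs <;> first | rfl | omega

theorem admFrom_face {f : Cubes (finiteNerve (m + 1) G) (n + 1)} {j : Fin (n + 1)} (ε : Bool)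
    (h : IsStableAt δ f j) {c : ℕ} (hc : AdmFrom δ f c) :
    AdmFrom δ ((finiteNerve (m + 1) G).map (Box.face j ε).op f)
      (if c ≤ j.1 then c else c - 1) := by
  intro v
  rw [finiteNerve_map_face, finiteNerve_map_face, ← inwardFrom_faceFun h]
  exact hc _

/-- The shifted position is admissible for the face but need not be its cutoff, so `cyl` with a free
position is needed instead of `maxCyl`. -/
theorem cyl_face_castSucc {f : Cubes (finiteNerve (m + 1) G) (n + 1)} {j : Fin (n + 1)} (ε : Bool)
    (h : IsStableAt δ f j) {c : ℕ} (hc : AdmFrom δ f c) :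
    (finiteNerve (m + 1) G).map (Box.face j.castSucc ε).op (cyl δ f c hc) =
      cyl δ ((finiteNerve (m + 1) G).map (Box.face j ε).op f) _ (admFrom_face ε h hc) := by
  refine Subtype.ext (funext fun v => ?_)
  have e₁ : faceFun j.castSucc (side (m + 1) ε) v (Fin.last (n + 1)) = v (Fin.last n) := by
    rw [faceFun_apply, dif_neg (by simp), dif_neg (by simp; omega)]
    rfl
  have e₂ : degenFun (Fin.last (n + 1)) (faceFun j.castSucc (side (m + 1) ε) v) =
      faceFun j (side (m + 1) ε) (degenFun (Fin.last n) v) := by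
    funext l
    simp only [degenFun_apply, faceFun_apply, Fin.val_castSucc, Fin.val_last]
    split_ifs <;> first | rfl | omega
  rw [finiteNerve_map_face, cyl_apply, cyl_apply, e₁, e₂, inwardFrom_faceFun h,
    finiteNerve_map_face, finiteNerve_map_face]

theorem maxCyl_of_stable {f : Cubes (finiteNerve (m + 1) G) n} (h : ∀ k, IsStableAt δ f k) :
    maxCyl δ f = (finiteNerve (m + 1) G).map (Box.degen (Fin.last n)).op f := by
  refine Subtype.ext (funext fun v => ?_)
  rw [maxCyl_apply, finiteNerve_map_degen, apply_inwardFrom_of_stable fun k _ => h k, ite_self]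

end Unstable

/-! ### Nondegenerate cubes -/

namespace Box

/-- The degeneracies and connections, as a predicate. -/
inductive IsElemDegen : ∀ {m n : ℕ}, (Box.mk m ⟶ Box.mk n) → Prop
  | degen {n : ℕ} (i : Fin (n + 1)) : IsElemDegen (degen i)
  | conn {n : ℕ} (i : Fin (n + 1)) (ε : Bool) : IsElemDegen (conn i ε)

/-- If the map lands in a proper face, projecting that coordinate away lowers the target dimension,
and the generator is split off there. -/
theorem exists_isElemDegen {m : ℕ} :
    ∀ {n : ℕ} (φ : Box.mk m ⟶ Box.mk n), n < m →
      ∃ (l : ℕ) (σ : Box.mk m ⟶ Box.mk l) (ψ : Box.mk l ⟶ Box.mk n),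
        IsElemDegen σ ∧ φ = σ ≫ ψ := by
  intro n
  induction n with
  | zero =>
    intro φ h
    obtain hφ | ⟨j, -⟩ := isDegen_or_hasConst φ
    · cases hφ with
      | id => exact absurd h (lt_irrefl _)
      | degen i hψ => exact ⟨_, _, _, .degen i, rfl⟩
      | conn i ε hψ => exact ⟨_, _, _, .conn i ε, rfl⟩
    · exact j.elim0
  | succ n ih =>
    intro φ h
    obtain hφ | ⟨j, c, hc⟩ := isDegen_or_hasConst φ
    · cases hφ with
      | id => exact absurd h (lt_irrefl _)
      | degen i hψ => exact ⟨_, _, _, .degen i, rfl⟩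
      | conn i ε hψ => exact ⟨_, _, _, .conn i ε, rfl⟩
    · obtain ⟨l, σ, ψ, hσ, e⟩ := ih (φ ≫ Box.degen j) ((Nat.lt_succ_self n).trans h)
      refine ⟨l, σ, ψ ≫ Box.face j c, hσ, ?_⟩
      rw [← Category.assoc, ← e]
      exact eq_comp_face hc

theorem IsElemDegen.exists_isFace {m n : ℕ} {σ : Box.mk m ⟶ Box.mk n} (h : IsElemDegen σ) :
    ∃ s : Box.mk n ⟶ Box.mk m, IsFace s ∧ s ≫ σ = 𝟙 _ := by
  cases h with
  | degen i => exact ⟨_, .mk i true, face_degen i true⟩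
  | conn i ε => exact ⟨_, .mk i.castSucc ε, face_conn i ε (.inl rfl)⟩

end Box

theorem nondeg_of_isElemDegen {X : CubicalSet.{u}} {n : ℕ} {x : Cubes X n}
    (h : ∀ (l : ℕ) (σ : Box.mk n ⟶ Box.mk l), Box.IsElemDegen σ → ∀ z : Cubes X l,
      X.map σ.op z ≠ x) : Nondeg x := by
  intro k hk z φ e
  obtain ⟨l, σ, ψ, hσ, rfl⟩ := Box.exists_isElemDegen φ hk
  rw [cubes_map_comp] at e
  exact h l σ hσ _ e

/-- Every degeneracy or connection has a face as a section, so if `x` came from `z` along one, `z`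
would be a face of `x` and thus in `A`. -/
theorem Nondeg.of_faces_mem {X : CubicalSet.{u}} {A : Subfunctor X} {n : ℕ} {x : Cubes X n}
    (hx : x ∉ A.obj _)
    (h : ∀ (l : ℕ) (φ : Box.mk l ⟶ Box.mk n), Box.IsFace φ → X.map φ.op x ∈ A.obj _) :
    Nondeg x := by
  refine nondeg_of_isElemDegen fun l σ hσ z e => hx ?_
  obtain ⟨s, hs, hsσ⟩ := hσ.exists_isFace
  have := h l s hs
  rw [← e, ← cubes_map_comp, hsσ, cubes_map_id] at this
  rw [← e]
  exact A.map _ this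

/-! ### The maps between finite nerves are anodyne -/

section Anodyne

variable {V : Type u} {G : SimpleGraph V} {m n : ℕ} {δ : Bool}

/-- Setting the last coordinate of `f` to the neutral end turns the hypothesis into a formula for
`f` as a homotopy of its face `g`, pushed from the cutoff of `f`. The same formula shows that `f`
and `g` have equal cutoffs. -/
theorem exists_maxCyl_eq (hm : 0 < m) {f : Cubes (finiteNerve (m + 1) G) (n + 1)}
    (h : (finiteNerve (m + 1) G).map (Box.conn (Fin.last n) δ).op f = maxCyl δ f) :
    maxCyl δ ((finiteNerve (m + 1) G).map (Box.face (Fin.last n) δ).op f) = f := by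
  have hv : ∀ (v : Fin (n + 1) → Fin (m + 2)) (t : Fin (m + 2)),
      f.1 (connFun (Fin.last n) δ (faceFun (Fin.last (n + 1)) t v)) =
        if t = side (m + 1) (!δ) then f.1 (inwardFrom δ (cutoff δ f) v) else f.1 v := by
    intro v t
    have := congrFun (congrArg Subtype.val h) (faceFun (Fin.last (n + 1)) t v)
    rw [finiteNerve_map_conn, maxCyl_apply, faceFun_self, degenFun_faceFun] at this
    exact this
  have conn_eq : ∀ (v : Fin n → Fin (m + 2)) (s t : Fin (m + 2)),
      connFun (Fin.last n) δ (faceFun (Fin.last (n + 1)) t (faceFun (Fin.last n) s v)) =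
        faceFun (Fin.last n) (connOp δ s t) v := by
    intro v s t
    funext l
    simp only [connFun_apply, faceFun_apply, Fin.val_last]
    grind
  have key : ∀ (v : Fin n → Fin (m + 2)) (t : Fin (m + 2)),
      f.1 (faceFun (Fin.last n) t v) = if t = side (m + 1) (!δ) then
        f.1 (inwardFrom δ (cutoff δ f) (faceFun (Fin.last n) (side (m + 1) δ) v))
        else f.1 (faceFun (Fin.last n) (side (m + 1) δ) v) := by
    intro v t
    rw [← hv, conn_eq, connOp_side]
  set g := (finiteNerve (m + 1) G).map (Box.face (Fin.last n) δ).op f with hg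
  have gv : ∀ v, f.1 (faceFun (Fin.last n) (side (m + 1) δ) v) = g.1 v := fun v =>
    (finiteNerve_map_face _ _ _ v).symm
  have push : ∀ (c : ℕ) (v : Fin n → Fin (m + 2)) (t : Fin (m + 2)), t ≠ side (m + 1) (!δ) →
      f.1 (inwardFrom δ c (faceFun (Fin.last n) t v)) = g.1 (inwardFrom δ c v) := by
    intro c v t ht
    have h₁ := faceFun_degenFun (Fin.last n) (inwardFrom δ c (faceFun (Fin.last n) t v))
    rw [degenFun_last_inwardFrom, degenFun_faceFun] at h₁
    rw [← h₁, key, if_neg, gv]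
    rwa [inwardFrom_last_eq_iff δ hm, faceFun_self]
  have push' : ∀ (c : ℕ) (v : Fin n → Fin (m + 2)),
      f.1 (inwardFrom δ c (faceFun (Fin.last n) (side (m + 1) (!δ)) v)) =
        g.1 (inwardFrom δ (cutoff δ f) (inwardFrom δ c v)) := by
    intro c v
    have h₁ := faceFun_degenFun (Fin.last n)
      (inwardFrom δ c (faceFun (Fin.last n) (side (m + 1) (!δ)) v))
    rw [degenFun_last_inwardFrom, degenFun_faceFun] at h₁
    rw [← h₁, key, if_pos, push _ _ _ (side_ne_side_not m δ)]
    rw [inwardFrom_last_eq_iff δ hm, faceFun_self]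
  have hfc : ∀ v t, f.1 (faceFun (Fin.last n) t v) = if t = side (m + 1) (!δ) then
      g.1 (inwardFrom δ (cutoff δ f) v) else g.1 v := by
    intro v t
    rw [key, push _ _ _ (side_ne_side_not m δ), gv]
  have adm_iff : ∀ c, AdmFrom δ f c ↔ AdmFrom δ g c := by
    intro c
    constructor
    · intro hc v
      have := hc (faceFun (Fin.last n) (side (m + 1) δ) v)
      rwa [push _ _ _ (side_ne_side_not m δ), gv] at this
    · intro hc v
      rw [← faceFun_degenFun (Fin.last n) v]
      by_cases ht : v (Fin.last n) = side (m + 1) (!δ)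
      · rw [ht, push', hfc, if_pos rfl, inwardFrom_comm]
        exact hc _
      · rw [push _ _ _ ht, hfc, if_neg ht]
        exact hc _
  have cut : cutoff δ f = cutoff δ g :=
    le_antisymm (cutoff_le ((adm_iff _).2 (admFrom_cutoff δ g)))
      (cutoff_le ((adm_iff _).1 (admFrom_cutoff δ f)))
  refine Subtype.ext (funext fun v => ?_)
  have := hfc (degenFun (Fin.last n) v) (v (Fin.last n))
  rw [faceFun_degenFun] at this
  rw [this, maxCyl_apply, cut]

/-- Taking the face at `δ`, most degeneracies and connections would make `f` degenerate. A
degeneracy in the last direction would equate the two end faces, against the count of unstable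
directions. The last connection of type `δ` would force `f` to be `maxCyl` of a face of `f`, hence
in `A`. -/
theorem nondeg_maxCyl (hm : 0 < m) {f : Cubes (finiteNerve (m + 1) G) n} (hf : Nondeg f)
    (hU : (unstable δ f).Nonempty) {A : Subfunctor (finiteNerve (m + 1) G)} (hfA : f ∉ A.obj _)
    (hA : ∀ (k : ℕ) (g : Cubes (finiteNerve (m + 1) G) k), g ∈ A.obj _ → maxCyl δ g ∈ A.obj _)
    (hface : ∀ (l : ℕ) (φ : Box.mk l ⟶ Box.mk n), Box.IsFace φ →
      (finiteNerve (m + 1) G).map φ.op f ∈ A.obj _) : Nondeg (maxCyl δ f) := by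
  refine nondeg_of_isElemDegen fun l σ hσ z e => ?_
  have hz : (finiteNerve (m + 1) G).map (Box.face (Fin.last n) δ ≫ σ).op z = f := by
    rw [cubes_map_comp, e]
    exact cyl_face δ f _ _
  cases hσ with
  | degen i =>
    by_cases hi : i = Fin.last n
    · subst hi
      rw [Box.face_degen, cubes_map_id] at hz
      subst hz
      have := card_unstable_face_maxCyl_lt hU
      rw [← e, ← cubes_map_comp, Box.face_degen, cubes_map_id] at this
      exact lt_irrefl _ this
    · obtain _ | n := n
      · exact hi (Subsingleton.elim (α := Fin 1) _ _)
      obtain ⟨i', j', h'⟩ := degenFun_faceFun_of_ne (α := Bool) hi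
      have e' : Box.face (Fin.last (n + 1)) δ ≫ Box.degen i = Box.degen i' ≫ Box.face j' δ :=
        Box.hom_ext fun x => h' δ x
      rw [e', cubes_map_comp] at hz
      exact hf n (Nat.lt_succ_self n) _ _ hz
  | @conn n i ε =>
    by_cases hi : i = Fin.last n
    · subst hi
      by_cases hε : δ = ε
      · subst hε
        rw [Box.face_conn (Fin.last n) δ (j := Fin.last (n + 1)) (.inr rfl), cubes_map_id] at hz
        subst hz
        exact hfA (exists_maxCyl_eq hm e ▸ hA _ _ (hface _ _ (.mk _ _)))
      · have e' : Box.face (Fin.last (n + 1)) δ ≫ Box.conn (Fin.last n) ε =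
            Box.degen (Fin.last n) ≫ Box.face (Fin.last n) δ :=
          Box.hom_ext fun x => connFun_faceFun_not hε (.inr rfl) x
        rw [e', cubes_map_comp] at hz
        exact hf n (Nat.lt_succ_self n) _ _ hz
    · obtain _ | n := n
      · exact hi (Subsingleton.elim (α := Fin 1) _ _)
      obtain ⟨i', j', h'⟩ := connFun_faceFun_of_ne (α := Bool) ε (i := i) (j := Fin.last (n + 2))
        (Fin.castSucc_lt_last i).ne' (fun e => hi (Fin.succ_injective _ (e.symm.trans rfl)))
      have e' : Box.face (Fin.last (n + 2)) δ ≫ Box.conn i ε =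
          Box.conn i' ε ≫ Box.face j' δ := Box.hom_ext fun x => h' δ x
      rw [e', cubes_map_comp] at hz
      exact hf _ (Nat.lt_succ_self _) _ _ hz

theorem maxCyl_map_mem {B : Subfunctor (finiteNerve (m + 1) G)} {k n : ℕ}
    {φ : Box.mk k ⟶ Box.mk n} (hφ : Box.IsDegen φ) (f : Cubes (finiteNerve (m + 1) G) n)
    (hf : maxCyl δ f ∈ B.obj _) :
    maxCyl δ ((finiteNerve (m + 1) G).map φ.op f) ∈ B.obj _ := by
  induction hφ with
  | id n => rwa [cubes_map_id]
  | degen i hφ ih =>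
    rw [cubes_map_comp, maxCyl_degen]
    exact B.map _ (ih f hf)
  | conn i ε hφ ih =>
    rw [cubes_map_comp, maxCyl_conn]
    exact B.map _ (ih f hf)

/-- Among the cubes outside a subobject choose one with the least number of unstable directions,
then of the least dimension, and then with the least cutoff. -/
theorem exists_minimal_not_mem (δ : Bool) {A : Subfunctor (finiteNerve (m + 1) G)} (hA : A ≠ ⊤) :
    ∃ (n : ℕ) (f : Cubes (finiteNerve (m + 1) G) n), f ∉ A.obj _ ∧
      (∀ (k : ℕ) (g : Cubes (finiteNerve (m + 1) G) k),
        (unstable δ g).card < (unstable δ f).card → g ∈ A.obj _) ∧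
      (∀ (k : ℕ) (g : Cubes (finiteNerve (m + 1) G) k),
        (unstable δ g).card ≤ (unstable δ f).card → k < n → g ∈ A.obj _) ∧
      ∀ g : Cubes (finiteNerve (m + 1) G) n,
        (unstable δ g).card ≤ (unstable δ f).card → cutoff δ g < cutoff δ f → g ∈ A.obj _ := by
  let S : Set (ℕ ×ₗ ℕ ×ₗ ℕ) := {t | ∃ (n : ℕ) (f : Cubes (finiteNerve (m + 1) G) n),
    f ∉ A.obj _ ∧ toLex ((unstable δ f).card, toLex (n, cutoff δ f)) = t}
  have hS : S.Nonempty := by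
    by_contra hS
    refine hA (Subfunctor.ext (funext fun ⟨⟨n⟩⟩ => Set.eq_univ_of_forall fun f => ?_))
    by_contra hf
    exact hS ⟨_, n, f, hf, rfl⟩
  obtain ⟨_, ⟨n, f, hf, rfl⟩, hmin⟩ :=
    (wellFounded_lt (α := ℕ ×ₗ ℕ ×ₗ ℕ)).has_min S hS
  have key : ∀ (k : ℕ) (g : Cubes (finiteNerve (m + 1) G) k),
      ((unstable δ g).card < (unstable δ f).card ∨ (unstable δ g).card = (unstable δ f).card ∧
        (k < n ∨ k = n ∧ cutoff δ g < cutoff δ f)) → g ∈ A.obj _ := by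
    intro k g h
    by_contra hg
    refine hmin _ ⟨k, g, hg, rfl⟩ ?_
    rw [Prod.Lex.toLex_lt_toLex, Prod.Lex.toLex_lt_toLex]
    exact h
  refine ⟨n, f, hf, fun k g h => key k g (.inl h), fun k g h hk => key k g ?_,
    fun g h hg => key n g ?_⟩
  · exact h.lt_or_eq.imp_right fun h => ⟨h, .inl hk⟩
  · exact h.lt_or_eq.imp_right fun h => ⟨h, .inr ⟨rfl, hg⟩⟩

/-- A minimal missing cube and its maximal homotopy are attached along the open box that omits the
face `(Fin.last n, δ)`. -/
theorem exists_larger_subfunctor (hm : 0 < m) {W : MorphismProperty CubicalSet.{u}}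
    (hW : IsSaturated W) (hW' : openBoxInclusions ≤ W)
    {A : Subfunctor (finiteNerve (m + 1) G)}
    (hs : ∀ (n : ℕ) (f : Cubes (finiteNerve (m + 1) G) n), (∀ k, IsStableAt δ f k) → f ∈ A.obj _)
    (hA : ∀ (n : ℕ) (f : Cubes (finiteNerve (m + 1) G) n), f ∈ A.obj _ → maxCyl δ f ∈ A.obj _)
    (hA' : A ≠ ⊤) :
    ∃ (A' : Subfunctor (finiteNerve (m + 1) G)) (h : A < A'),
      (∀ (n : ℕ) (f : Cubes (finiteNerve (m + 1) G) n), f ∈ A'.obj _ → maxCyl δ f ∈ A'.obj _) ∧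
      W (Subfunctor.homOfLe h.le) := by
  obtain ⟨n, f, hfA, h₁, h₂, h₃⟩ := exists_minimal_not_mem δ hA'
  have hU : (unstable δ f).Nonempty := by
    rw [Finset.nonempty_iff_ne_empty]
    intro h
    refine hfA (hs n f fun k => ?_)
    by_contra hk
    have := mem_unstable.2 hk
    rw [h] at this
    exact absurd this (Finset.notMem_empty k)
  have hface : ∀ (l : ℕ) (φ : Box.mk l ⟶ Box.mk n), Box.IsFace φ →
      (finiteNerve (m + 1) G).map φ.op f ∈ A.obj _ := by
    rintro l _ ⟨i, ε⟩
    exact h₂ _ _ (card_unstable_face_le f i ε) (Nat.lt_succ_self _)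
  have hf : Nondeg f := .of_faces_mem hfA hface
  have hy := nondeg_maxCyl hm hf hU hfA hA hface
  have hyf : (finiteNerve (m + 1) G).map (Box.face (Fin.last n) δ).op (maxCyl δ f) = f :=
    cyl_face δ f _ _
  have hyA : ∀ q ≠ (Fin.last n, δ),
      (finiteNerve (m + 1) G).map (Box.face q.1 q.2).op (maxCyl δ f) ∈ A.obj _ := by
    rintro ⟨j, ε⟩ hq
    refine Fin.lastCases (motive := fun j => (j, ε) ≠ (Fin.last n, δ) →
      (finiteNerve (m + 1) G).map (Box.face j ε).op (maxCyl δ f) ∈ A.obj _) ?_ ?_ j hq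
    · intro hq
      obtain rfl : ε = !δ := by
        have : ε ≠ δ := fun e => hq (by rw [e])
        revert this
        cases ε <;> cases δ <;> simp
      exact h₁ _ _ (card_unstable_face_maxCyl_lt hU)
    · intro j _
      obtain _ | n := n
      · exact j.elim0
      have hc := card_unstable_cyl_le hm f _ (admFrom_cutoff δ f)
      -- Passing to a face in an unstable direction lowers the count. In a stable direction the face
      -- is a homotopy of a face `g` of `f`, and its position is compared with the cutoff of `g`.
      by_cases hj : j ∈ unstable δ f
      · refine h₁ _ _ (lt_of_lt_of_le (card_unstable_face_lt ε ?_) hc)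
        have := mem_unstable_cyl _ (admFrom_cutoff δ f) hj
        rwa [Fin.succAbove_last] at this
      · have hj : IsStableAt δ f j := by
          by_contra hj'
          exact hj (mem_unstable.2 hj')
        have hg := hface _ _ (.mk j ε)
        have ha := admFrom_face ε hj (admFrom_cutoff δ f)
        have e := cyl_face_castSucc ε hj (admFrom_cutoff δ f)
        -- If the homotopy of `g` is not maximal, its cutoff is that of `g`, which is less than that
        -- of `f`; this is what the third entry of the order is for. If it is maximal, closure of
        -- `A` under `maxCyl` applies.
        obtain hlt | heq := (cutoff_le ha).lt_or_eq
        · refine h₃ _ ((card_unstable_face_le _ _ _).trans hc) ?_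
          rw [maxCyl, e, cutoff_cyl δ hm]
          refine hlt.trans_le ?_
          split_ifs <;> omega
        · rw [maxCyl, e, cyl_eq_maxCyl δ _ ha heq.symm]
          exact hA _ _ hg
  have hlt : A < A ⊔ Subfunctor.ofSection (maxCyl δ f) := by
    refine lt_of_le_of_ne le_sup_left fun e => hfA ?_
    rw [← hyf]
    refine A.map _ ?_
    rw [e]
    exact Or.inr (Subfunctor.mem_ofSection_obj _)
  refine ⟨A ⊔ Subfunctor.ofSection (maxCyl δ f), hlt, ?_,
    homOfLe_attach hW hW' A (Fin.last n, δ) hy (by rwa [hyf]) (by rwa [hyf]) hyA⟩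
  have hy' : maxCyl δ f ∈ (A ⊔ Subfunctor.ofSection (maxCyl δ f)).obj _ :=
    Or.inr (Subfunctor.mem_ofSection_obj _)
  rintro k _ (hg | ⟨φ, rfl⟩)
  · exact Or.inl (hA _ _ hg)
  · change maxCyl δ ((finiteNerve (m + 1) G).map φ.unop.op (maxCyl δ f)) ∈ _
    generalize φ.unop = φ
    -- A new cube is a degeneracy of `maxCyl δ f` or of `f`. Since `maxCyl` respects degeneracies
    -- and connections, only these two cubes matter, and `maxCyl_maxCyl` handles the first.
    by_cases hφ : ∃ q ≠ (Fin.last n, δ), ∀ x, φ.1 x q.1 = q.2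
    · obtain ⟨q, hq, h⟩ := hφ
      refine Or.inl (hA _ _ ?_)
      rw [Box.eq_comp_face h, cubes_map_comp]
      exact A.map _ (hyA q hq)
    · obtain hφ | ⟨ψ, hψ, rfl⟩ := isDegen_or_of_not_mem_openBox hφ
      · refine maxCyl_map_mem hφ _ ?_
        rw [maxCyl_maxCyl δ hm]
        exact Subfunctor.map _ _ hy'
      · rw [cubes_map_comp, hyf]
        exact maxCyl_map_mem hψ _ hy'

/-- A map of cubical sets that is injective, and whose image consists of the cubes that are stable
in all directions, is anodyne. -/
theorem anodyne_of_range_stable (hm : 0 < m) (δ : Bool) {X : CubicalSet.{u}}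
    (r : X ⟶ finiteNerve (m + 1) G) (hr : ∀ n, Function.Injective (r.app (op (Box.mk n))))
    (hr' : ∀ (n : ℕ) (f : Cubes (finiteNerve (m + 1) G) n),
      (∃ g, r.app (op (Box.mk n)) g = f) ↔ ∀ k, IsStableAt δ f k) : Anodyne r := by
  intro W hW hW'
  have := hW.pushouts
  have := hW.transfinite
  have mem : ∀ (n : ℕ) (f : Cubes (finiteNerve (m + 1) G) n),
      f ∈ (Subfunctor.range r).obj _ ↔ ∀ k, IsStableAt δ f k := hr'
  have h : W (Subfunctor.range r).ι := by
    -- The invariant holds at the start because `maxCyl` of a cube that is stable in all directions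
    -- is degenerate.
    refine subfunctor_ι_mem hW (P := fun A => (∀ (n : ℕ) (f : Cubes (finiteNerve (m + 1) G) n),
        (∀ k, IsStableAt δ f k) → f ∈ A.obj _) ∧
      ∀ (n : ℕ) (f : Cubes (finiteNerve (m + 1) G) n), f ∈ A.obj _ → maxCyl δ f ∈ A.obj _)
      ?_ ?_ ?_
    · rintro S ⟨A, hA⟩ - hS
      refine ⟨fun n f hf => le_sSup hA _ ((hS A hA).1 n f hf), fun n f hf => ?_⟩
      rw [Subfunctor.sSup_obj] at hf
      obtain ⟨_, ⟨B, hB, rfl⟩, hf⟩ := hf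
      exact le_sSup hB _ ((hS B hB).2 n f hf)
    · rintro A ⟨hs, hA⟩ hA'
      obtain ⟨A', hlt, h, hWA⟩ := exists_larger_subfunctor hm hW hW' hs hA hA'
      exact ⟨A', hlt, ⟨fun n f hf => hlt.le _ (hs n f hf), h⟩, hWA⟩
    · refine ⟨fun n f => (mem n f).2, fun n f hf => ?_⟩
      rw [maxCyl_of_stable ((mem n f).1 hf)]
      exact Subfunctor.map _ _ hf
  have hiso : IsIso (Subfunctor.toRange r) := by
    have : ∀ b, IsIso ((Subfunctor.toRange r).app b) := by
      rintro ⟨⟨n⟩⟩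
      rw [isIso_iff_bijective]
      refine ⟨fun a b h => hr n (congrArg Subtype.val h), ?_⟩
      rintro ⟨_, a, rfl⟩
      exact ⟨a, rfl⟩
    exact NatIso.isIso_of_isIso_app _
  rw [← Subfunctor.toRange_ι r]
  exact W.comp_mem _ _ (W.of_isIso _) h

theorem anodyne_lStar (hm : 0 < m) (G : SimpleGraph V) : Anodyne (lStar m G) := by
  have hl : ∀ t : Fin (m + 1), lMap m t.succ = t := fun t => Fin.ext (by simp [lMap])
  have hl' : ∀ t : Fin (m + 2), lMap m (inward false t) = lMap m t := fun t => Fin.ext (by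
    simp only [lMap, inward_val, Bool.false_eq_true, if_false]
    omega)
  -- `inward false` is `l` followed by its section `Fin.succ`, so a cube is in the image of `l^*`
  -- exactly if it is stable in all directions.
  have hl'' : ∀ t : Fin (m + 2), inward false t = (lMap m t).succ := fun t => Fin.ext (by
    simp only [lMap, inward_val, Bool.false_eq_true, if_false, Fin.val_succ]
    omega)
  refine anodyne_of_range_stable hm false _ (fun n => ?_) fun n f => ⟨?_, fun h => ?_⟩
  · rintro ⟨f, hf⟩ ⟨g, hg⟩ h
    refine Subtype.ext (funext fun v => ?_)
    have : f (fun i => lMap m (v i).succ) = g (fun i => lMap m (v i).succ) :=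
      congrFun (congrArg Subtype.val h) fun i => (v i).succ
    simpa only [hl] using this
  · rintro ⟨g, rfl⟩ k v
    refine congrArg g.1 (funext fun l => ?_)
    by_cases hlk : l = k
    · subst hlk
      rw [Function.update_self, hl']
    · rw [Function.update_of_ne hlk]
  · refine ⟨⟨fun v => f.1 fun i => (v i).succ, f.2.comp (isGraphMap_pi ?_ n)⟩, ?_⟩
    · exact isGraphMap_of_finCovBy fun x y h => Or.inl (congrArg (· + 1) h)
    · refine Subtype.ext (funext fun v => ?_)
      refine Eq.trans ?_ (apply_inwardFrom_of_stable (c := 0) (fun k _ => h k) v)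
      exact congrArg f.1 (funext fun i => (hl'' (v i)).symm)

theorem anodyne_rStar (hm : 0 < m) (G : SimpleGraph V) : Anodyne (rStar m G) := by
  have hl : ∀ t : Fin (m + 1), rMap m t.castSucc = t := fun t => Fin.ext (by
    simp only [rMap, Fin.val_castSucc]
    omega)
  have hl' : ∀ t : Fin (m + 2), rMap m (inward true t) = rMap m t := fun t => Fin.ext (by
    simp only [rMap, inward_val, if_true]
    omega)
  have hl'' : ∀ t : Fin (m + 2), inward true t = (rMap m t).castSucc := fun t => rfl
  refine anodyne_of_range_stable hm true _ (fun n => ?_) fun n f => ⟨?_, fun h => ?_⟩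
  · rintro ⟨f, hf⟩ ⟨g, hg⟩ h
    refine Subtype.ext (funext fun v => ?_)
    have : f (fun i => rMap m (v i).castSucc) = g (fun i => rMap m (v i).castSucc) :=
      congrFun (congrArg Subtype.val h) fun i => (v i).castSucc
    simpa only [hl] using this
  · rintro ⟨g, rfl⟩ k v
    refine congrArg g.1 (funext fun l => ?_)
    by_cases hlk : l = k
    · subst hlk
      rw [Function.update_self, hl']
    · rw [Function.update_of_ne hlk]
  · refine ⟨⟨fun v => f.1 fun i => (v i).castSucc, f.2.comp (isGraphMap_pi ?_ n)⟩, ?_⟩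
    · exact isGraphMap_of_finCovBy fun x y h => Or.inl h
    · refine Subtype.ext (funext fun v => ?_)
      refine Eq.trans ?_ (apply_inwardFrom_of_stable (c := 0) (fun k _ => h k) v)
      exact congrArg f.1 (funext fun i => (hl'' (v i)).symm)

end Anodyne

end DiscreteCubical

open DiscreteCubical in
theorem theorem4p1 {V : Type u} (G : SimpleGraph V) :
    IsKanComplex (nerve G) ∧
    Nonempty (CategoryTheory.Limits.IsColimit (nerveCocone G)) ∧
    (∀ m : ℕ, 0 < m → Anodyne (lStar m G) ∧ Anodyne (rStar m G)) ∧
    Anodyne (nerveIncl 1 G) := by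
  have h : ∀ m : ℕ, 0 < m → Anodyne (lStar m G) ∧ Anodyne (rStar m G) :=
    fun m hm => ⟨anodyne_lStar hm G, anodyne_rStar hm G⟩
  exact ⟨isKanComplex_nerve G, nonempty_isColimit_nerveCocone G, h,
    fun W hW hW' => nerveIncl_one_mem hW G fun m hm => ⟨(h m hm).1 W hW hW', (h m hm).2 W hW hW'⟩⟩
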